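/- Let $n\ge 1$, $1<p<\infty$, $0<q<p-1$, $0<\alpha<\frac np$, and let $\sigma\neq 0$ be a nonnegative locally finite Borel measure on $\mathbb{R}^n$. For a locally finite Borel measure $\nu\ge 0$ on $\mathbb{R}^n$ let $$\mathbf W_{\alpha,p}\nu(x)=\int_0^\infty\Big[\frac{\nu(B(x,r))}{r^{n-\alpha p}}\Big]^{\frac1{p-1}}\frac{dr}{r}\in[0,\infty],\qquad x\in\mathbb{R}^n,$$ where $B(x,r)$ is the open ball. For a Borel set $E\subset\mathbb R^n$ let $\kappa(E)\in[0,\infty]$ be the least constant in the inequality $$\Big(\int_E(\mathbf W_{\alpha,p}\nu)^q\,d\sigma\Big)^{\frac1q}\le\kappa(E)\,\nu(\mathbb{R}^n)^{\frac1{p-1}}\quad\text{for all locally finite Borel measures }\nu\ge0,$$ and let $$\mathbf K_{\alpha,p}\sigma(x)=\int_0^\infty\Big[\frac{\kappa(B(x,s))^{\frac{q(p-1)}{p-1-q}}}{s^{n-\alpha p}}\Big]^{\frac1{p-1}}\frac{ds}{s},\qquad x\in\mathbb{R}^n.$$ Consider the conditions $$\text{(a)}\ \int_1^\infty\Big[\frac{\sigma(B(0,r))}{r^{n-\alpha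 p}}\Big]^{\frac1{p-1}}\frac{dr}{r}<\infty,\qquad \text{(b)}\ \int_1^\infty\Big[\frac{\kappa(B(0,s))^{\frac{q(p-1)}{p-1-q}}}{s^{n-\alpha p}}\Big]^{\frac1{p-1}}\frac{ds}{s}<\infty,$$ $$\text{(c)}\ \int_B(\mathbf W_{\alpha,p}\sigma_B)^{\frac{(1+q)(p-1)}{p-1-q}}\,d\sigma<\infty\ \text{ for all balls }B\subset\mathbb{R}^n,\ \text{ where }\sigma_B=\sigma|_B.$$ If (a), (b) and (c) hold, then there exists a Borel function $u:\mathbb R^n\to(0,\infty]$ in $L^{1+q}_{\rm loc}(\mathbb R^n,d\sigma)$ with $u=\mathbf W_{\alpha,p}(u^q\,d\sigma)$ everywhere on $\mathbb{R}^n$, such that, for all $x\in\mathbb{R}^n$, $$C^{-1}\Big[\mathbf K_{\alpha,p}\sigma(x)+\big(\mathbf W_{\alpha,p}\sigma(x)\big)^{\frac{p-1}{p-1-q}}\Big]\le u(x)\le C\Big[\mathbf K_{\alpha,p}\sigma(x)+\big(\mathbf W_{\alpha,p}\sigma(x)\big)^{\frac{p-1}{p-1-q}}\Big],$$ where $C>0$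 depends only on $n,p,q,\alpha$. Conversely, if there exists a nontrivial (that is, not $\sigma$-a.e. zero) $\sigma$-measurable function $u\ge0$ in $L^{1+q}_{\rm loc}(\mathbb R^n,d\sigma)$ with $u=\mathbf W_{\alpha,p}(u^q\,d\sigma)$ $\sigma$-a.e. (in particular, if $u>0$ and the equation holds everywhere), then (a), (b) and (c) all hold. -/

import Mathlib

open MeasureTheory Set Metric
open scoped ENNReal NNReal

noncomputable section

namespace WolffEq

/-- The integral `∫_t^∞ (φ(r) / r^(n - α p))^(1/(p-1)) dr / r`, with values in `[0, ∞]`. It is the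
common form of the Wolff potential (`t = 0`, `φ(r) = σ(B(x, r))`), of the intrinsic potential, and
of the conditions at infinity. It is only used for `0 ≤ t`. -/
def tailIntegral (n : ℕ) (α p : ℝ) (φ : ℝ → ℝ≥0∞) (t : ℝ) : ℝ≥0∞ :=
  ∫⁻ r in Ioi t, (φ r / ENNReal.ofReal (r ^ ((n : ℝ) - α * p))) ^ (1 / (p - 1)) / ENNReal.ofReal r

/-- The Wolff potential `W_{α,p} σ (x) = ∫_0^∞ (σ(B(x, r)) / r^(n - α p))^(1/(p-1)) dr / r`. -/
def wolffPotential {n : ℕ} (α p : ℝ) (σ : Measure (EuclideanSpace ℝ (Fin n)))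
    (x : EuclideanSpace ℝ (Fin n)) : ℝ≥0∞ :=
  tailIntegral n α p (fun r => σ (ball x r)) 0

/-- `κ(E)`: the least constant `c` in `[0, ∞]` such that
`(∫_E (W_{α,p} ν)^q dσ)^(1/q) ≤ c * ν(ℝⁿ)^(1/(p-1))` for all locally finite Borel measures `ν`
(it is `∞` if the inequality holds with no finite constant). -/
def kappa {n : ℕ} (α p q : ℝ) (σ : Measure (EuclideanSpace ℝ (Fin n)))
    (E : Set (EuclideanSpace ℝ (Fin n))) : ℝ≥0∞ :=
  sInf {c : ℝ≥0∞ | ∀ ν : Measure (EuclideanSpace ℝ (Fin n)), IsLocallyFiniteMeasure ν →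
    (∫⁻ y in E, wolffPotential α p ν y ^ q ∂σ) ^ (1 / q) ≤ c * ν univ ^ (1 / (p - 1))}

/-- The intrinsic potential of Wolff type,
`K_{α,p} σ (x) = ∫_0^∞ (κ(B(x, s))^(q(p-1)/(p-1-q)) / s^(n - α p))^(1/(p-1)) ds / s`. -/
def intrinsicPotential {n : ℕ} (α p q : ℝ) (σ : Measure (EuclideanSpace ℝ (Fin n)))
    (x : EuclideanSpace ℝ (Fin n)) : ℝ≥0∞ :=
  tailIntegral n α p (fun s => kappa α p q σ (ball x s) ^ (q * (p - 1) / (p - 1 - q))) 0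

/-- `∫_1^∞ (σ(B(0, r)) / r^(n - α p))^(1/(p-1)) dr / r < ∞`. -/
def WolffFiniteAtInfinity {n : ℕ} (α p : ℝ) (σ : Measure (EuclideanSpace ℝ (Fin n))) : Prop :=
  tailIntegral n α p (fun r => σ (ball 0 r)) 1 < ∞

/-- `∫_1^∞ (κ(B(0, s))^(q(p-1)/(p-1-q)) / s^(n - α p))^(1/(p-1)) ds / s < ∞`. -/
def IntrinsicFiniteAtInfinity {n : ℕ} (α p q : ℝ)
    (σ : Measure (EuclideanSpace ℝ (Fin n))) : Prop :=
  tailIntegral n α p (fun s => kappa α p q σ (ball 0 s) ^ (q * (p - 1) / (p - 1 - q))) 1 < ∞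

/-- `∫_B (W_{α,p} σ_B)^((1+q)(p-1)/(p-1-q)) dσ < ∞` for all balls `B`, where `σ_B` is the
restriction of `σ` to `B`. -/
def LocalWolffCondition {n : ℕ} (α p q : ℝ) (σ : Measure (EuclideanSpace ℝ (Fin n))) : Prop :=
  ∀ (x : EuclideanSpace ℝ (Fin n)) (R : ℝ), 0 < R →
    ∫⁻ y in ball x R,
      wolffPotential α p (σ.restrict (ball x R)) y ^ ((1 + q) * (p - 1) / (p - 1 - q)) ∂σ < ∞

/-- `u ∈ L^s_loc(ℝⁿ, dσ)` for a `[0, ∞]`-valued function `u` and `s > 0`. -/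
def MemLsLoc {n : ℕ} (s : ℝ) (σ : Measure (EuclideanSpace ℝ (Fin n)))
    (u : EuclideanSpace ℝ (Fin n) → ℝ≥0∞) : Prop :=
  AEMeasurable u σ ∧
    ∀ K : Set (EuclideanSpace ℝ (Fin n)), IsCompact K → ∫⁻ x in K, u x ^ s ∂σ < ∞

/-- `u` is a (Borel measurable, positive) solution of `u = W_{α,p}(u^q dσ)` everywhere on `ℝⁿ`.
As for the potentials themselves, the value `∞` is allowed at exceptional points. -/
structure IsSolution {n : ℕ} (α p q : ℝ) (σ : Measure (EuclideanSpace ℝ (Fin n)))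
    (u : EuclideanSpace ℝ (Fin n) → ℝ≥0∞) : Prop where
  measurable : Measurable u
  pos : ∀ x, 0 < u x
  eq : ∀ x, u x = wolffPotential α p (σ.withDensity fun y => u y ^ q) x

/-- `u` is a nontrivial solution of `u = W_{α,p}(u^q dσ)` in the weaker sense of equality
`σ`-almost everywhere. -/
structure IsSolutionAE {n : ℕ} (α p q : ℝ) (σ : Measure (EuclideanSpace ℝ (Fin n)))
    (u : EuclideanSpace ℝ (Fin n) → ℝ≥0∞) : Prop where
  aemeasurable : AEMeasurable u σ
  nontrivial : ¬ u =ᵐ[σ] 0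
  eq : ∀ᵐ x ∂σ, u x = wolffPotential α p (σ.withDensity fun y => u y ^ q) x

/-- For `σ ≠ 0`, a positive solution everywhere is a nontrivial solution almost everywhere. -/
theorem IsSolution.isSolutionAE {n : ℕ} {α p q : ℝ} {σ : Measure (EuclideanSpace ℝ (Fin n))}
    {u : EuclideanSpace ℝ (Fin n) → ℝ≥0∞} (hσ : σ ≠ 0) (h : IsSolution α p q σ u) :
    IsSolutionAE α p q σ u where
  aemeasurable := h.measurable.aemeasurable
  nontrivial := fun h0 => by
    have hF : ∀ᵐ _ ∂σ, False := by
      filter_upwards [h0] with x hx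
      exact (h.pos x).ne' hx
    have : (ae σ).NeBot := ae_neBot.2 hσ
    exact hF.exists.choose_spec
  eq := Filter.Eventually.of_forall h.eq

end WolffEq

end

/-! Put δ = q/(p-1) < 1, b = (p-1)/(p-1-q) = 1/(1-δ), s = qb and V = K + (W σ)^b. The map u ↦ W(u^q
dσ) is monotone and homogeneous of degree δ, so a one-sided bound with constant a improves to one
with constant c·a^δ, and the constants are driven to the fixed point c^b. All comparisons below rest
on this sublinearity.

Lower bound. Every supersolution dominates (W σ)^b (`exists_le_supersolution`), because truncations
of (W σ)^b are subsolutions up to a constant. It also dominates K: the quotient Wν/Wω is bounded by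
a power of the centred maximal function of ν relative to ω, whose weak type bound follows from
Besicovitch's theorem. With ω = u^q dσ, Kolmogorov's inequality gives κ(E)^s ≤ C ∫_E u^q dσ
(`exists_kappa_rpow_le`), and integrating over balls gives K ≤ C u.

Upper bound. V is a supersolution up to a constant (`exists_wolffPotential_le_tailPotential`). If
κ(B(x,2r)) is finite, then σ restricted to that ball has a supersolution u whose q-mass is at most
κ(B(x,2r))^s. On B(x,r), V is at most C(u + V(x)), since the scales above r hardly depend on the
centre. Integrating over r leaves K(x) and V(x)^δ W σ(x), both at most a multiple of V(x). Hence
iterates started from a small subsolution stay below L·V and increase to a solution. None of (a),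
(b), (c) is needed for this.

The conditions only govern local integrability. By (c), a strong type maximal inequality and Hölder,
each ball carries a supersolution of finite energy; (a) and (b) make the tail of V finite.
Conversely, the lower bounds, read at a point where u is finite and integrated over balls, return
the three conditions. -/

noncomputable section

namespace WolffEq

/-! ### Calculus of the tail integrals in one variable. -/

section Tail

variable {n : ℕ} {α p : ℝ} {φ ψ : ℝ → ℝ≥0∞} {t : ℝ}

theorem tailIntegral_mono (hp : 1 < p) (h : ∀ r, t < r → φ r ≤ ψ r) :
    tailIntegral n α p φ t ≤ tailIntegral n α p ψ t := by
  have : 0 ≤ 1 / (p - 1) := by have := sub_pos.2 hp; positivity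
  refine setLIntegral_mono' measurableSet_Ioi fun r hr => ?_
  gcongr
  exact h r hr

theorem tailIntegral_anti {t' : ℝ} (h : t ≤ t') :
    tailIntegral n α p φ t' ≤ tailIntegral n α p φ t :=
  lintegral_mono_set (Ioi_subset_Ioi h)

theorem measurable_tailIntegrand (hφ : Measurable φ) :
    Measurable fun r : ℝ => (φ r / ENNReal.ofReal (r ^ ((n : ℝ) - α * p))) ^ (1 / (p - 1)) /
      ENNReal.ofReal r := by
  fun_prop

theorem tailIntegral_const_mul (hp : 1 < p) (hφ : Measurable φ) (c : ℝ≥0∞) :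
    tailIntegral n α p (fun r => c * φ r) t = c ^ (1 / (p - 1)) * tailIntegral n α p φ t := by
  have : 0 ≤ 1 / (p - 1) := by have := sub_pos.2 hp; positivity
  unfold tailIntegral
  rw [← lintegral_const_mul _ (measurable_tailIntegrand hφ)]
  congr with r
  rw [mul_div_assoc, ENNReal.mul_rpow_of_nonneg _ _ this, mul_div_assoc]

theorem add_rpow_le {γ : ℝ} (hγ : 0 ≤ γ) (x y : ℝ≥0∞) :
    (x + y) ^ γ ≤ 2 ^ γ * (x ^ γ + y ^ γ) := by
  have : x + y ≤ 2 * max x y := by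
    rw [two_mul]; exact add_le_add (le_max_left _ _) (le_max_right _ _)
  calc (x + y) ^ γ ≤ (2 * max x y) ^ γ := by gcongr
    _ = 2 ^ γ * (max x y) ^ γ := ENNReal.mul_rpow_of_nonneg _ _ hγ
    _ ≤ _ := by
      gcongr
      rcases max_choice x y with h | h <;> rw [h]
      · exact le_self_add
      · exact le_add_self

theorem tailIntegral_add_le (hp : 1 < p) (hφ : Measurable φ) :
    tailIntegral n α p (fun r => φ r + ψ r) t ≤
      2 ^ (1 / (p - 1)) * (tailIntegral n α p φ t + tailIntegral n α p ψ t) := by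
  have h0 : 0 ≤ 1 / (p - 1) := by have := sub_pos.2 hp; positivity
  unfold tailIntegral
  rw [← lintegral_add_left (measurable_tailIntegrand hφ), ← lintegral_const_mul']
  · refine lintegral_mono fun r => ?_
    rw [← ENNReal.add_div, ← mul_div_assoc]
    gcongr
    rw [ENNReal.add_div]
    exact add_rpow_le h0 _ _
  · exact (ENNReal.rpow_lt_top_of_nonneg h0 (by simp)).ne

/-- Since dr/r is invariant under dilations, only the normalising power of r produces a factor. -/
theorem tailIntegral_comp_mul (hp : 1 < p) {c : ℝ} (hc : 0 < c) (ht : 0 ≤ t) :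
    tailIntegral n α p (fun r => φ (c * r)) t =
      ENNReal.ofReal (c ^ ((n : ℝ) - α * p)) ^ (1 / (p - 1)) * tailIntegral n α p φ (c * t) := by
  have h0 : 0 ≤ 1 / (p - 1) := by have := sub_pos.2 hp; positivity
  unfold tailIntegral
  have hme : MeasurableEmbedding (fun x : ℝ => c * x) :=
    (Homeomorph.mulLeft₀ c hc.ne').isClosedEmbedding.measurableEmbedding
  have key : ∀ f : ℝ → ℝ≥0∞, ∫⁻ r in Ioi (c * t), f r =
      ENNReal.ofReal c * ∫⁻ r in Ioi t, f (c * r) := by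
    intro f
    have := Real.smul_map_volume_mul_left hc.ne'
    conv_lhs => rw [← this]
    rw [Measure.restrict_smul, lintegral_smul_measure, hme.restrict_map, hme.lintegral_map,
      abs_of_pos hc, smul_eq_mul]
    congr 3
    ext x
    rw [mem_preimage, mem_Ioi, mem_Ioi, mul_lt_mul_iff_right₀ hc]
  rw [key, ← mul_assoc, ← lintegral_const_mul' _ _ (by finiteness)]
  refine setLIntegral_congr_fun measurableSet_Ioi fun r hr => ?_
  have hr0 : 0 < r := ht.trans_lt hr
  dsimp only
  have hca : 0 < c ^ ((n : ℝ) - α * p) := by positivity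
  have e1 : ENNReal.ofReal ((c * r) ^ ((n : ℝ) - α * p)) =
      ENNReal.ofReal (c ^ ((n : ℝ) - α * p)) * ENNReal.ofReal (r ^ ((n : ℝ) - α * p)) := by
    rw [Real.mul_rpow hc.le hr0.le, ENNReal.ofReal_mul hca.le]
  have e2 : ENNReal.ofReal (c * r) = ENNReal.ofReal c * ENNReal.ofReal r :=
    ENNReal.ofReal_mul hc.le
  have hra : 0 < r ^ ((n : ℝ) - α * p) := by positivity
  have e3 : φ (c * r) / ENNReal.ofReal (r ^ ((n : ℝ) - α * p)) =
      ENNReal.ofReal (c ^ ((n : ℝ) - α * p)) *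
        (φ (c * r) / ENNReal.ofReal ((c * r) ^ ((n : ℝ) - α * p))) := by
    rw [e1, ← mul_div_assoc, ENNReal.mul_div_mul_left _ _ (by simpa using hca) (by simp)]
  rw [e3, ENNReal.mul_rpow_of_nonneg _ _ h0, e2]
  set X := (φ (c * r) / ENNReal.ofReal ((c * r) ^ ((n : ℝ) - α * p))) ^ (1 / (p - 1))
  have e4 : X / ENNReal.ofReal r = ENNReal.ofReal c * (X / (ENNReal.ofReal c * ENNReal.ofReal r)) := by
    rw [← mul_div_assoc, ENNReal.mul_div_mul_left _ _ (by simpa using hc) (by simp)]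
  rw [mul_div_assoc, e4, mul_assoc]

theorem tailIntegral_pos (hp : 1 < p) {m : ℝ≥0∞} (hm : m ≠ 0) :
    0 < tailIntegral n α p (fun _ => m) t := by
  have h0 : 0 < 1 / (p - 1) := by have := sub_pos.2 hp; positivity
  unfold tailIntegral
  rw [pos_iff_ne_zero, Ne, lintegral_eq_zero_iff (measurable_tailIntegrand measurable_const),
    Filter.EventuallyEq, ae_restrict_iff' measurableSet_Ioi]
  intro h
  have hz : volume (Ioi t) = 0 := by
    refine measure_mono_null (fun r hr => ?_) h
    simp only [mem_compl_iff, mem_ofPred_eq, Classical.not_imp]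
    refine ⟨hr, ?_⟩
    simp only [Pi.zero_apply]
    rw [ENNReal.div_eq_zero_iff, ENNReal.rpow_eq_zero_iff_of_pos h0, ENNReal.div_eq_zero_iff]
    simp [hm]
  simp at hz

/-- The set where the tail of an integral is smaller than `θ` contributes at most `θ`. -/
theorem lintegral_tail_lt_le (g : ℝ → ℝ≥0∞) (θ : ℝ≥0∞) :
    ∫⁻ r in {r : ℝ | 0 < r ∧ ∫⁻ x in Ioi r, g x < θ}, g r ≤ θ := by
  set S : Set ℝ := {r : ℝ | 0 < r ∧ ∫⁻ x in Ioi r, g x < θ} with hS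
  rcases S.eq_empty_or_nonempty with h | h
  · simp [h]
  have hbdd : BddBelow S := ⟨0, fun r hr => hr.1.le⟩
  obtain ⟨v, hv_anti, hv_lim, hv_mem⟩ := exists_seq_tendsto_sInf h hbdd
  -- Up to the null point `sInf S`, the set is exhausted by rays whose endpoints belong to `S`, and
  -- each such ray has integral below θ.
  have hsub : S ⊆ (⋃ k, Ioi (v k)) ∪ {sInf S} := by
    intro r hr
    rcases (csInf_le hbdd hr).eq_or_lt with h1 | h1
    · right; exact h1.symm
    · left
      obtain ⟨k, hk⟩ := (hv_lim.eventually (gt_mem_nhds h1)).exists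
      exact mem_iUnion.2 ⟨k, hk⟩
  have hmono : Monotone fun k => Ioi (v k) := fun i j hij => Ioi_subset_Ioi (hv_anti hij)
  calc ∫⁻ r in S, g r ≤ ∫⁻ r in (⋃ k, Ioi (v k)) ∪ {sInf S}, g r := lintegral_mono_set hsub
    _ = ∫⁻ r in ⋃ k, Ioi (v k), g r := by
      refine setLIntegral_congr ?_
      exact union_ae_eq_left_of_ae_eq_empty (by simp)
    _ = ⨆ k, ∫⁻ r in Ioi (v k), g r := by
      rw [setLIntegral_iUnion_of_directed _ (hmono.directed_le)]
    _ ≤ θ := iSup_le fun k => (hv_mem k).2.le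

/-- An integrated form of the chain rule for powers of the tail of an integral. -/
theorem le_lintegral_mul_tail_rpow {g : ℝ → ℝ≥0∞} (hg : Measurable g) {τ : ℝ} (hτ : 0 ≤ τ)
    {m : ℝ≥0∞} (hm : m ≠ ∞) (hmg : m ≤ ∫⁻ r in Ioi 0, g r) :
    (m / 2) ^ (1 + τ) ≤ ∫⁻ r in Ioi 0, g r * (min (∫⁻ x in Ioi r, g x) m) ^ τ := by
  set S : Set ℝ := {r : ℝ | 0 < r ∧ ∫⁻ x in Ioi r, g x < m / 2} with hS
  have hanti : Antitone fun r : ℝ => ∫⁻ x in Ioi r, g x := fun a b hab =>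
    lintegral_mono_set (Ioi_subset_Ioi hab)
  have hSm : MeasurableSet S :=
    measurableSet_Ioi.inter (measurableSet_lt hanti.measurable measurable_const)
  have hSub : S ⊆ Ioi 0 := fun r hr => hr.1
  -- The radii with tail below m/2 carry at most m/2 of the integral; the rest still carries m/2,
  -- and there the tail is at least m/2.
  have h1 : m / 2 ≤ ∫⁻ r in Ioi 0 \ S, g r := by
    have h2 := lintegral_inter_add_sdiff (μ := volume) g (Ioi 0) hSm
    have h3 : ∫⁻ r in Ioi 0 ∩ S, g r ≤ m / 2 := by
      rw [inter_eq_self_of_subset_right hSub]; exact lintegral_tail_lt_le g _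
    have h4 : m / 2 + m / 2 ≤ m / 2 + ∫⁻ r in Ioi 0 \ S, g r := by
      rw [ENNReal.add_halves]
      calc m ≤ _ := hmg
        _ = _ := h2.symm
        _ ≤ _ := by gcongr
    exact (ENNReal.add_le_add_iff_left (by finiteness)).1 h4
  calc (m / 2) ^ (1 + τ) = (m / 2) * (m / 2) ^ τ := by
        rw [ENNReal.rpow_add_of_nonneg _ _ zero_le_one hτ, ENNReal.rpow_one]
    _ ≤ (∫⁻ r in Ioi 0 \ S, g r) * (m / 2) ^ τ := by gcongr
    _ = ∫⁻ r in Ioi 0 \ S, g r * (m / 2) ^ τ := (lintegral_mul_const _ hg).symm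
    _ ≤ ∫⁻ r in Ioi 0 \ S, g r * (min (∫⁻ x in Ioi r, g x) m) ^ τ := by
      refine setLIntegral_mono' (measurableSet_Ioi.diff hSm) fun r hr => ?_
      gcongr
      refine le_min ?_ ENNReal.half_le_self
      by_contra! hlt
      exact hr.2 ⟨hr.1, hlt⟩
    _ ≤ _ := lintegral_mono_set sdiff_subset

end Tail

/-! ### Comparison of tail integrals over balls with different centres. -/

section Balls

variable {n : ℕ} {α p : ℝ} {φ ψ : ℝ → ℝ≥0∞} {Φ : Set (EuclideanSpace ℝ (Fin n)) → ℝ≥0∞}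
  {x y : EuclideanSpace ℝ (Fin n)}

theorem tailIntegral_iSup (hp : 1 < p) {f : ℕ → ℝ → ℝ≥0∞} (hf : ∀ k, Measurable (f k))
    (hmono : Monotone f) (t : ℝ) :
    tailIntegral n α p (fun r => ⨆ k, f k r) t = ⨆ k, tailIntegral n α p (f k) t := by
  have h0 : 0 < 1 / (p - 1) := by have := sub_pos.2 hp; positivity
  unfold tailIntegral
  rw [← lintegral_iSup fun k => measurable_tailIntegrand (hf k)]
  · congr with r
    rw [← ENNReal.iSup_div, ENNReal.iSup_div]
    congr 1
    exact (ENNReal.orderIsoRpow _ h0).map_iSup _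
  · intro i j hij r
    dsimp only
    gcongr
    exact hmono hij r

theorem tailIntegral_le_of_forall_le (hp : 1 < p) {r : ℝ} (hr : 0 ≤ r)
    (h : ∀ t, 0 < t → t ≤ r → φ t ≤ ψ t) :
    tailIntegral n α p φ 0 ≤ tailIntegral n α p ψ 0 + tailIntegral n α p φ r := by
  have h0 : 0 ≤ 1 / (p - 1) := by have := sub_pos.2 hp; positivity
  unfold tailIntegral
  rw [← Ioc_union_Ioi_eq_Ioi hr]
  refine (lintegral_union_le _ _ _).trans (add_le_add_left ?_ _)
  refine (setLIntegral_mono' measurableSet_Ioc (g := fun t =>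
    (ψ t / ENNReal.ofReal (t ^ ((n : ℝ) - α * p))) ^ (1 / (p - 1)) / ENNReal.ofReal t)
      fun t ht => ?_).trans (lintegral_mono_set subset_union_left)
  gcongr
  exact h t ht.1 ht.2

theorem measurable_comp_ball (hΦ : Monotone Φ) (x : EuclideanSpace ℝ (Fin n)) :
    Measurable fun r => Φ (ball x r) :=
  Monotone.measurable fun _ _ h => hΦ (ball_subset_ball h)

/-- The factor that appears when the radius is doubled. -/
def doublingConst (n : ℕ) (α p : ℝ) : ℝ≥0∞ :=
  ENNReal.ofReal (2 ^ ((n : ℝ) - α * p)) ^ (1 / (p - 1))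

theorem doublingConst_pos : 0 < doublingConst n α p := by
  unfold doublingConst
  exact ENNReal.rpow_pos (by simp; positivity) (by simp)

theorem doublingConst_ne_top (hp : 1 < p) : doublingConst n α p ≠ ∞ := by
  have h0 : 0 ≤ 1 / (p - 1) := by have := sub_pos.2 hp; positivity
  exact (ENNReal.rpow_lt_top_of_nonneg h0 (by simp)).ne

/-- For t > r the ball B(y,t) lies in B(x,2t), so moving the centre costs one doubling. A general
monotone `Φ` covers both σ and powers of κ. -/
theorem tailIntegral_ball_le (hp : 1 < p) (hΦ : Monotone Φ) {r : ℝ} (hr : 0 ≤ r)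
    (hxy : dist x y ≤ r) :
    tailIntegral n α p (fun t => Φ (ball y t)) r ≤
      doublingConst n α p * tailIntegral n α p (fun t => Φ (ball x t)) r := by
  calc tailIntegral n α p (fun t => Φ (ball y t)) r
      ≤ tailIntegral n α p (fun t => Φ (ball x (2 * t))) r :=
        tailIntegral_mono hp fun t ht => hΦ (ball_subset_ball' (by rw [dist_comm]; linarith))
    _ = doublingConst n α p * tailIntegral n α p (fun t => Φ (ball x t)) (2 * r) :=
        tailIntegral_comp_mul hp (φ := fun t => Φ (ball x t)) two_pos hr
    _ ≤ _ := by
        gcongr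
        exact tailIntegral_anti (by linarith)

theorem tailIntegral_ball_zero_lt_top (hp : 1 < p) (hΦ : Monotone Φ)
    (h : tailIntegral n α p (fun t => Φ (ball x t)) 0 < ∞) :
    tailIntegral n α p (fun t => Φ (ball 0 t)) 1 < ∞ := by
  have h0 : 0 ≤ 1 / (p - 1) := by have := sub_pos.2 hp; positivity
  have hL : 0 < 1 + ‖x‖ := by positivity
  calc tailIntegral n α p (fun t => Φ (ball 0 t)) 1
      ≤ tailIntegral n α p (fun t => Φ (ball x ((1 + ‖x‖) * t))) 1 :=
        tailIntegral_mono hp fun t ht => hΦ (ball_subset_ball' (by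
          rw [dist_zero_left]; nlinarith [norm_nonneg x]))
    _ = _ := tailIntegral_comp_mul hp (φ := fun t => Φ (ball x t)) hL zero_le_one
    _ ≤ ENNReal.ofReal ((1 + ‖x‖) ^ ((n : ℝ) - α * p)) ^ (1 / (p - 1)) *
        tailIntegral n α p (fun t => Φ (ball x t)) 0 := by
        gcongr
        exact tailIntegral_anti (by positivity)
    _ < ∞ := ENNReal.mul_lt_top (ENNReal.rpow_lt_top_of_nonneg h0 (by simp)) h

end Balls

/-! ### Elementary properties of Wolff potentials. -/

section Wolff

variable {n : ℕ} {α p q : ℝ} {μ ν : Measure (EuclideanSpace ℝ (Fin n))}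
  {x y : EuclideanSpace ℝ (Fin n)}

theorem measure_monotone (μ : Measure (EuclideanSpace ℝ (Fin n))) :
    Monotone fun s => μ s := fun _ _ h => measure_mono h

theorem measurable_measure_ball (μ : Measure (EuclideanSpace ℝ (Fin n)))
    (x : EuclideanSpace ℝ (Fin n)) : Measurable fun r => μ (ball x r) :=
  measurable_comp_ball (measure_monotone μ) x

theorem wolffPotential_mono (hp : 1 < p) (h : ∀ r, μ (ball x r) ≤ ν (ball x r)) :
    wolffPotential α p μ x ≤ wolffPotential α p ν x :=
  tailIntegral_mono hp fun r _ => h r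

theorem wolffPotential_mono_measure (hp : 1 < p) (h : μ ≤ ν) :
    wolffPotential α p μ x ≤ wolffPotential α p ν x :=
  wolffPotential_mono hp fun _ => h _

theorem wolffPotential_zero_measure (hp : 1 < p) :
    wolffPotential α p (0 : Measure (EuclideanSpace ℝ (Fin n))) x = 0 := by
  have hγ : 0 < 1 / (p - 1) := by have := sub_pos.2 hp; positivity
  simp only [wolffPotential, tailIntegral, Measure.coe_zero, Pi.zero_apply, ENNReal.zero_div,
    ENNReal.zero_rpow_of_pos hγ, lintegral_zero]

/-- This is how a quotient of two Wolff potentials is controlled by a centred maximal function. -/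
theorem wolffPotential_le_of_forall_ball_le (hp : 1 < p) {l : ℝ≥0∞}
    (h : ∀ r, 0 < r → ν (ball x r) ≤ l * μ (ball x r)) :
    wolffPotential α p ν x ≤ l ^ (1 / (p - 1)) * wolffPotential α p μ x :=
  (tailIntegral_mono hp h).trans_eq (tailIntegral_const_mul hp (measurable_measure_ball μ x) l)

theorem measurable_wolffPotential [SFinite ν] : Measurable (wolffPotential α p ν) := by
  unfold wolffPotential tailIntegral
  have h1 : Measurable fun z : EuclideanSpace ℝ (Fin n) × ℝ => ν (ball z.1 z.2) := by
    have hs : MeasurableSet {w : (EuclideanSpace ℝ (Fin n) × ℝ) × EuclideanSpace ℝ (Fin n) |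
        dist w.2 w.1.1 < w.1.2} := by
      apply IsOpen.measurableSet
      exact isOpen_lt (by fun_prop) (by fun_prop)
    exact measurable_measure_prodMk_left hs
  refine Measurable.lintegral_prod_right' (f := fun z : EuclideanSpace ℝ (Fin n) × ℝ =>
    (ν (ball z.1 z.2) / ENNReal.ofReal (z.2 ^ ((n : ℝ) - α * p))) ^ (1 / (p - 1)) /
      ENNReal.ofReal z.2) ?_
  exact ((h1.div (by fun_prop)).pow_const _).div (by fun_prop)

/-- Once r exceeds |R| + k, every B(y,r) with y in the ball contains the fixed charged ball B(0,k).
The uniformity in y provides the initial positive constant in `exists_le_supersolution`. -/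
theorem exists_pos_le_wolffPotential (hp : 1 < p) (hν : ν ≠ 0) (R : ℝ) :
    ∃ m : ℝ≥0∞, 0 < m ∧ ∀ y ∈ ball (0 : EuclideanSpace ℝ (Fin n)) R,
      m ≤ wolffPotential α p ν y := by
  obtain ⟨k, hk⟩ : ∃ k : ℕ, ν (ball 0 k) ≠ 0 := by
    by_contra! h
    have : ν univ = 0 := by
      rw [← iUnion_ball_nat (0 : EuclideanSpace ℝ (Fin n))]
      exact measure_iUnion_null h
    exact hν (Measure.measure_univ_eq_zero.1 this)
  refine ⟨_, tailIntegral_pos (n := n) (α := α) (t := |R| + k) hp hk, fun y hy => ?_⟩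
  refine (tailIntegral_mono hp fun r hr => ?_).trans (tailIntegral_anti (t := 0) (by positivity))
  refine measure_mono (ball_subset_ball' ?_)
  rw [dist_comm]
  have := mem_ball.1 hy
  have := le_abs_self R
  linarith

theorem wolffPotential_pos (hp : 1 < p) (hν : ν ≠ 0) (x : EuclideanSpace ℝ (Fin n)) :
    0 < wolffPotential α p ν x := by
  obtain ⟨m, hm, h⟩ := exists_pos_le_wolffPotential (α := α) hp hν (‖x‖ + 1)
  exact hm.trans_le (h x (by simp))

theorem wolffPotential_withDensity (f : EuclideanSpace ℝ (Fin n) → ℝ≥0∞) :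
    wolffPotential α p (μ.withDensity f) x =
      tailIntegral n α p (fun r => ∫⁻ y in ball x r, f y ∂μ) 0 := by
  simp only [wolffPotential, withDensity_apply _ measurableSet_ball]

theorem wolffPotential_withDensity_mono (hp : 1 < p) {f g : EuclideanSpace ℝ (Fin n) → ℝ≥0∞}
    (h : f ≤ᵐ[μ] g) :
    wolffPotential α p (μ.withDensity f) x ≤ wolffPotential α p (μ.withDensity g) x :=
  wolffPotential_mono_measure hp (withDensity_mono h)

theorem measurable_setLIntegral_ball (f : EuclideanSpace ℝ (Fin n) → ℝ≥0∞) :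
    Measurable fun r => ∫⁻ y in ball x r, f y ∂μ :=
  measurable_comp_ball (Φ := fun s => ∫⁻ y in s, f y ∂μ) (fun _ _ h => lintegral_mono_set h) x

theorem wolffPotential_withDensity_const_mul (hp : 1 < p) (c : ℝ≥0∞)
    {f : EuclideanSpace ℝ (Fin n) → ℝ≥0∞} (hf : Measurable f) :
    wolffPotential α p (μ.withDensity fun y => c * f y) x =
      c ^ (1 / (p - 1)) * wolffPotential α p (μ.withDensity f) x := by
  rw [wolffPotential_withDensity, wolffPotential_withDensity,
    ← tailIntegral_const_mul hp (measurable_setLIntegral_ball f)]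
  simp_rw [lintegral_const_mul c hf]

theorem wolffPotential_withDensity_iSup (hp : 1 < p) {f : ℕ → EuclideanSpace ℝ (Fin n) → ℝ≥0∞}
    (hf : ∀ k, Measurable (f k)) (hmono : Monotone f) :
    wolffPotential α p (μ.withDensity fun y => ⨆ k, f k y) x =
      ⨆ k, wolffPotential α p (μ.withDensity (f k)) x := by
  simp_rw [wolffPotential_withDensity, lintegral_iSup hf hmono]
  exact tailIntegral_iSup hp (fun k => measurable_setLIntegral_ball _)
    (fun i j hij r => lintegral_mono (hmono hij)) 0

theorem wolffPotential_eq_iSup_restrict (hp : 1 < p) :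
    wolffPotential α p μ x = ⨆ k : ℕ, wolffPotential α p (μ.restrict (ball 0 k)) x := by
  have hmono : Monotone fun k : ℕ => ball (0 : EuclideanSpace ℝ (Fin n)) k :=
    fun i j hij => ball_subset_ball (by exact_mod_cast hij)
  unfold wolffPotential
  rw [← tailIntegral_iSup hp (fun k => measurable_measure_ball _ _)]
  · congr with r
    simp_rw [Measure.restrict_apply measurableSet_ball]
    rw [← Monotone.measure_iUnion, ← inter_iUnion, iUnion_ball_nat, inter_univ]
    exact fun i j hij => inter_subset_inter_right _ (hmono hij)
  · exact fun i j hij r => Measure.restrict_mono (hmono hij) le_rfl _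

theorem tailIntegral_measure_ball_le (hp : 1 < p) {r : ℝ} (hr : 0 ≤ r) (hxy : dist x y ≤ r) :
    tailIntegral n α p (fun t => μ (ball x t)) r ≤
      doublingConst n α p * wolffPotential α p μ y :=
  (tailIntegral_ball_le hp (measure_monotone μ) hr (by rwa [dist_comm])).trans
    (by gcongr; exact tailIntegral_anti hr)

/-- Local splitting of the Wolff potential. -/
theorem wolffPotential_le_restrict_add (hp : 1 < p) {r : ℝ} (hr : 0 ≤ r) (hy : y ∈ ball x r) :
    wolffPotential α p μ y ≤ wolffPotential α p (μ.restrict (ball x (2 * r))) y +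
      doublingConst n α p * tailIntegral n α p (fun t => μ (ball x t)) r := by
  refine (tailIntegral_le_of_forall_le hp hr fun t _ ht => ?_).trans
    (add_le_add le_rfl (tailIntegral_ball_le hp (measure_monotone μ) hr (mem_ball'.1 hy).le))
  rw [Measure.restrict_apply measurableSet_ball, inter_eq_self_of_subset_left]
  refine ball_subset_ball' ?_
  have := mem_ball.1 hy
  linarith

end Wolff

/-! ### Weak type maximal estimate and Kolmogorov's inequality. -/

section WeakType

/-- The weak type estimate for the centred maximal function of a measure with respect to another
one, from the Besicovitch covering theorem. -/
theorem exists_weakType_const (n : ℕ) : ∃ N : ℕ, ∀ (ω ν : Measure (EuclideanSpace ℝ (Fin n))),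
    ∀ l : ℝ≥0∞, l * ω {x | ∃ r : ℝ, 0 < r ∧ l * ω (ball x r) < ν (ball x r)} ≤ N * ν univ := by
  obtain ⟨N, τ, hτ, hN⟩ :=
    HasBesicovitchCovering.no_satelliteConfig (α := EuclideanSpace ℝ (Fin n))
  refine ⟨N, fun ω ν l => ?_⟩
  -- Besicovitch's theorem needs bounded radii, and disjointness is available for closed balls. Open
  -- balls are exhausted by closed ones for ν, while ω only decreases.
  set S : ℕ → Set (EuclideanSpace ℝ (Fin n)) := fun k =>
    {x | ∃ r : ℝ, 0 < r ∧ r ≤ k ∧ l * ω (closedBall x r) < ν (closedBall x r)} with hS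
  have hSmono : Monotone S := by
    rintro i j hij x ⟨r, h1, h2, h3⟩
    exact ⟨r, h1, h2.trans (by exact_mod_cast hij), h3⟩
  have hsub : {x | ∃ r : ℝ, 0 < r ∧ l * ω (ball x r) < ν (ball x r)} ⊆ ⋃ k, S k := by
    rintro x ⟨r, hr, h⟩
    obtain ⟨v, hv, hvm, hlim⟩ := exists_seq_strictMono_tendsto' hr
    have hU : ball x r = ⋃ j, closedBall x (v j) := by
      ext y
      simp only [mem_ball, mem_iUnion, mem_closedBall]
      constructor
      · intro hy
        obtain ⟨j, hj⟩ := (hlim.eventually (lt_mem_nhds hy)).exists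
        exact ⟨j, hj.le⟩
      · rintro ⟨j, hj⟩
        exact hj.trans_lt (hvm j).2
    have hm : Monotone fun j => closedBall x (v j) := fun i j hij =>
      closedBall_subset_closedBall (hv.monotone hij)
    have h' : l * ω (ball x r) < ⨆ j, ν (closedBall x (v j)) := by
      rwa [← hm.measure_iUnion, ← hU]
    rw [lt_iSup_iff] at h'
    obtain ⟨j, hj⟩ := h'
    obtain ⟨k, hk⟩ := exists_nat_ge (v j)
    refine mem_iUnion.2 ⟨k, v j, (hvm j).1, hk, lt_of_le_of_lt ?_ hj⟩
    gcongr
    exact closedBall_subset_ball (hvm j).2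
  have hk : ∀ k, l * ω (S k) ≤ N * ν univ := by
    intro k
    choose! r hr0 hrk hr using fun x (hx : x ∈ S k) => hx
    let P : Besicovitch.BallPackage (S k) (EuclideanSpace ℝ (Fin n)) :=
      { c := fun x => x
        r := fun x => r x
        rpos := fun x => hr0 x x.2
        r_bound := k
        r_le := fun x => hrk x x.2 }
    obtain ⟨s, hdisj, hcov⟩ := Besicovitch.exist_disjoint_covering_families hτ hN P
    have hcount : ∀ i, (s i).Countable := fun i =>
      (hdisj i).countable_of_nonempty_interior fun j _ =>
        (nonempty_ball.2 (P.rpos _)).mono ball_subset_interior_closedBall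
    have hcov' : S k ⊆ ⋃ i : Fin N, ⋃ j ∈ s i, ball (P.c j) (P.r j) := by
      refine subset_trans (fun x hx => ?_) hcov
      exact ⟨⟨x, hx⟩, rfl⟩
    calc l * ω (S k) ≤ l * ∑ i : Fin N, ∑' j : s i, ω (ball (P.c j) (P.r j)) := by
          gcongr
          refine (measure_mono hcov').trans ((measure_iUnion_fintype_le _ _).trans ?_)
          exact Finset.sum_le_sum fun i _ => measure_biUnion_le _ (hcount i) _
      _ = ∑ i : Fin N, ∑' j : s i, l * ω (ball (P.c j) (P.r j)) := by
          simp_rw [Finset.mul_sum, ENNReal.tsum_mul_left]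
      _ ≤ ∑ _i : Fin N, ν univ := by
          refine Finset.sum_le_sum fun i _ => ?_
          calc ∑' j : s i, l * ω (ball (P.c j) (P.r j))
              ≤ ∑' j : s i, ν (closedBall (P.c j) (P.r j)) := by
                refine ENNReal.tsum_le_tsum fun j => ?_
                refine le_trans ?_ (hr j j.1.2).le
                gcongr
                exact ball_subset_closedBall
            _ = ν (⋃ j ∈ s i, closedBall (P.c j) (P.r j)) :=
                (measure_biUnion (hcount i) (hdisj i)
                  fun j _ => isClosed_closedBall.measurableSet).symm
            _ ≤ ν univ := measure_mono (subset_univ _)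
      _ = N * ν univ := by simp
  calc _ ≤ l * ω (⋃ k, S k) := by gcongr
    _ = ⨆ k, l * ω (S k) := by rw [hSmono.measure_iUnion, ENNReal.mul_iSup]
    _ ≤ _ := iSup_le hk

/-- Kolmogorov's inequality: a weak type estimate controls small powers on a finite measure. -/
theorem exists_lintegral_rpow_le_of_weakType {δ : ℝ} (hδ0 : 0 < δ) (hδ1 : δ < 1) :
    ∃ C : ℝ≥0∞, C ≠ 0 ∧ C ≠ ∞ ∧ ∀ {X : Type} [MeasurableSpace X] (ω : Measure X)
      (h : X → ℝ≥0∞) (A : ℝ≥0∞), A ≠ 0 → A ≠ ∞ → ω univ ≠ 0 → ω univ ≠ ∞ → Measurable h →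
      (∀ l : ℝ≥0∞, l ≠ 0 → l ≠ ∞ → l * ω {x | l < h x} ≤ A) →
      ∫⁻ x, h x ^ δ ∂ω ≤ C * (ω univ ^ (1 - δ) * A ^ δ) := by
  -- Ratio of the dyadic series: the level 2^k L contributes (2^(k+1) L)^δ · A/(2^k L).
  set ρ : ℝ≥0∞ := 2 ^ (δ - 1) with hρ
  have hρ1 : ρ < 1 := ENNReal.rpow_lt_one_of_one_lt_of_neg (by norm_num) (by linarith)
  refine ⟨1 + 2 ^ δ * (1 - ρ)⁻¹, by simp, ?_, ?_⟩
  · have : (1 - ρ)⁻¹ ≠ ∞ := ENNReal.inv_ne_top.2 (tsub_pos_of_lt hρ1).ne'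
    have h2 : (2 : ℝ≥0∞) ^ δ ≠ ∞ := (ENNReal.rpow_lt_top_of_nonneg hδ0.le (by simp)).ne
    finiteness
  intro X _ ω h A hA0 hA hω0 hω hh hw
  set m := ω univ with hm
  -- The level at which the trivial bound m for the distribution function equals the weak type bound
  -- A/L.
  set L : ℝ≥0∞ := A / m with hL
  have hL0 : L ≠ 0 := (ENNReal.div_pos hA0 hω).ne'
  have hLt : L ≠ ∞ := ENNReal.div_ne_top hA hω0
  have hpt : ∀ x, h x ^ δ ≤ L ^ δ + ∑' k : ℕ, {x | 2 ^ k * L < h x}.indicator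
      (fun _ => (2 ^ (k + 1) * L) ^ δ) x := by
    intro x
    by_cases hx : h x ≤ L
    · exact le_add_right (by gcongr)
    push Not at hx
    refine le_add_left ?_
    by_cases hinf : h x = ∞
    · have : ∑' k : ℕ, {x | 2 ^ k * L < h x}.indicator (fun _ => (2 ^ (k + 1) * L) ^ δ) x = ∞ := by
        have h1 : ∑' _k : ℕ, L ^ δ = ∞ :=
          ENNReal.tsum_const_eq_top_of_ne_zero (ENNReal.rpow_pos hL0.bot_lt hLt).ne'
        rw [← top_le_iff, ← h1]
        refine ENNReal.tsum_le_tsum fun k => ?_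
        rw [indicator_of_mem (by
          show 2 ^ k * L < h x
          rw [hinf]; exact ENNReal.mul_lt_top (by finiteness) hLt.lt_top)]
        gcongr
        exact le_mul_of_one_le_left' (one_le_pow₀ (by norm_num))
      rw [this]; exact le_top
    · obtain ⟨k, hk1, hk2⟩ : ∃ k : ℕ, 2 ^ k * L < h x ∧ h x ≤ 2 ^ (k + 1) * L := by
        have hex : ∃ k : ℕ, h x ≤ 2 ^ k * L := by
          have : Filter.Tendsto (fun k : ℕ => (2 : ℝ≥0∞) ^ k * L) Filter.atTop (nhds (∞ * L)) :=
            ENNReal.Tendsto.mul_const (ENNReal.tendsto_pow_atTop_nhds_top_iff.2 (by norm_num))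
              (Or.inl (by simp))
          rw [ENNReal.top_mul hL0] at this
          obtain ⟨k, hk⟩ := (this.eventually (lt_mem_nhds (Ne.lt_top hinf))).exists
          exact ⟨k, hk.le⟩
        classical
        have hf := Nat.find_spec hex
        rcases hk : Nat.find hex with _ | k
        · rw [hk] at hf
          simp only [pow_zero, one_mul] at hf
          exact absurd hf (not_le.2 hx)
        · refine ⟨k, ?_, hk ▸ hf⟩
          have := Nat.find_min hex (m := k) (by omega)
          exact not_le.1 this
      refine le_trans ?_ (ENNReal.le_tsum k)
      rw [indicator_of_mem (by exact hk1)]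
      gcongr
  have hmeas : ∀ k : ℕ, MeasurableSet {x | 2 ^ k * L < h x} := fun k =>
    measurableSet_lt measurable_const hh
  calc ∫⁻ x, h x ^ δ ∂ω
      ≤ ∫⁻ x, (L ^ δ + ∑' k : ℕ, {x | 2 ^ k * L < h x}.indicator
          (fun _ => (2 ^ (k + 1) * L) ^ δ) x) ∂ω := lintegral_mono hpt
    _ = L ^ δ * m + ∑' k : ℕ, (2 ^ (k + 1) * L) ^ δ * ω {x | 2 ^ k * L < h x} := by
        rw [lintegral_add_left measurable_const, lintegral_const,
          lintegral_tsum fun k => (measurable_const.indicator (hmeas k)).aemeasurable]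
        congr 1
        congr with k
        rw [lintegral_indicator_const (hmeas k)]
    _ ≤ L ^ δ * m + ∑' k : ℕ, L ^ δ * m * 2 ^ δ * ρ ^ k := by
        refine add_le_add le_rfl (ENNReal.tsum_le_tsum fun k => ?_)
        have h2k0 : (2 : ℝ≥0∞) ^ k ≠ 0 := by simp
        have h2kt : (2 : ℝ≥0∞) ^ k ≠ ∞ := by finiteness
        have hwk : ω {x | 2 ^ k * L < h x} ≤ A / (2 ^ k * L) := by
          rw [ENNReal.le_div_iff_mul_le (Or.inl (mul_ne_zero h2k0 hL0))
            (Or.inl (ENNReal.mul_ne_top h2kt hLt)), mul_comm]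
          exact hw _ (mul_ne_zero h2k0 hL0) (ENNReal.mul_ne_top h2kt hLt)
        have hAL : A / L = m := by
          rw [hL, ENNReal.div_eq_inv_mul, ENNReal.inv_div (Or.inl hω) (Or.inl hω0),
            ENNReal.div_mul_cancel hA0 hA]
        calc (2 ^ (k + 1) * L) ^ δ * ω {x | 2 ^ k * L < h x}
            ≤ (2 ^ (k + 1) * L) ^ δ * (A / (2 ^ k * L)) := by gcongr
          _ = L ^ δ * m * 2 ^ δ * ρ ^ k := by
            have e1 : A / (2 ^ k * L) = (2 ^ k)⁻¹ * m := by
              simp only [← hAL, ENNReal.div_eq_inv_mul]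
              rw [ENNReal.mul_inv (Or.inl h2k0) (Or.inl h2kt), mul_assoc]
            have e2 : ρ ^ k = (2 ^ k) ^ δ * (2 ^ k)⁻¹ := by
              rw [hρ, ENNReal.rpow_sub _ _ (by simp) (by simp), ENNReal.rpow_one,
                ENNReal.div_eq_inv_mul, mul_pow, ENNReal.inv_pow, mul_comm]
              congr 1
              rw [← ENNReal.rpow_natCast, ← ENNReal.rpow_natCast, ← ENNReal.rpow_mul,
                ← ENNReal.rpow_mul, mul_comm]
            rw [e1, e2, pow_succ, ENNReal.mul_rpow_of_nonneg _ _ hδ0.le,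
              ENNReal.mul_rpow_of_nonneg _ _ hδ0.le]
            ring
    _ = (1 + 2 ^ δ * (1 - ρ)⁻¹) * (L ^ δ * m) := by
        rw [ENNReal.tsum_mul_left, ENNReal.tsum_geometric]
        ring
    _ = (1 + 2 ^ δ * (1 - ρ)⁻¹) * (m ^ (1 - δ) * A ^ δ) := by
        congr 1
        rw [hL, ENNReal.div_rpow_of_nonneg _ _ hδ0.le, ENNReal.rpow_sub _ _ hω0 hω,
          ENNReal.rpow_one, ENNReal.div_eq_inv_mul, ENNReal.div_eq_inv_mul]
        ring

end WeakType

/-! ### Supersolutions dominate a power of the Wolff potential. -/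

section Lower

variable {n : ℕ} {α p q : ℝ}

/-- A lower bound for the Wolff potential of powers of a truncated Wolff potential. -/
theorem exists_le_wolffPotential_min (n : ℕ) (α : ℝ) (hp : 1 < p) (hq : 0 < q) (hqp : q < p - 1) :
    ∃ c : ℝ≥0∞, c ≠ 0 ∧ c ≠ ∞ ∧ ∀ (μ : Measure (EuclideanSpace ℝ (Fin n))) [SFinite μ],
      ∀ k : ℝ≥0∞, k ≠ ∞ → ∀ x,
        c * min (wolffPotential α p μ x) k ^ ((p - 1) / (p - 1 - q)) ≤
          wolffPotential α p (μ.withDensity fun y =>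
            (min (wolffPotential α p μ y) k ^ ((p - 1) / (p - 1 - q))) ^ q) x := by
  have hp1 : 0 < p - 1 := by linarith
  have hpq : 0 < p - 1 - q := by linarith
  have hγ : 0 ≤ 1 / (p - 1) := by positivity
  set b := (p - 1) / (p - 1 - q) with hb
  have hb0 : 0 < b := by positivity
  -- The density (W^b)^q enters the potential with exponent 1/(p-1), hence as W^τ; the value of b is
  -- the one for which 1 + τ = b.
  set τ := b * q * (1 / (p - 1)) with hτ
  have hτ0 : 0 ≤ τ := by positivity
  have hτb : 1 + τ = b := by rw [hτ, hb]; field_simp; ring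
  set D := max (doublingConst n α p) 1 with hD
  have hD0 : D ≠ 0 := by simp [hD]
  have hDt : D ≠ ∞ := by simp [hD, doublingConst_ne_top hp]
  have hDi : D⁻¹ ^ τ ≠ ∞ := (ENNReal.rpow_lt_top_of_nonneg hτ0 (by simp [hD0])).ne
  refine ⟨D⁻¹ ^ τ * 2⁻¹ ^ b, ?_, ?_, fun μ _ k hk x => ?_⟩
  · refine mul_ne_zero (ENNReal.rpow_pos (by simp [hDt]) (by simp [hD0])).ne'
      (ENNReal.rpow_pos (by simp) (by simp)).ne'
  · exact ENNReal.mul_ne_top hDi (ENNReal.rpow_lt_top_of_nonneg hb0.le (by simp)).ne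
  set W := wolffPotential α p μ with hW
  set m := min (W x) k with hm
  have hmt : m ≠ ∞ := ne_top_of_le_ne_top hk (min_le_right _ _)
  set g : ℝ → ℝ≥0∞ := fun r =>
    (μ (ball x r) / ENNReal.ofReal (r ^ ((n : ℝ) - α * p))) ^ (1 / (p - 1)) / ENNReal.ofReal r
    with hg
  have hgm : Measurable g := measurable_tailIntegrand (measurable_measure_ball μ x)
  have hkey := le_lintegral_mul_tail_rpow hgm hτ0 hmt (min_le_left (W x) k)
  rw [hτb, ENNReal.div_eq_inv_mul, ENNReal.mul_rpow_of_nonneg _ _ hb0.le] at hkey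
  have hgt : ∀ r, ∫⁻ t in Ioi r, g t = tailIntegral n α p (fun r => μ (ball x r)) r := fun r => rfl
  simp_rw [hgt] at hkey
  set T : ℝ → ℝ≥0∞ := fun r => tailIntegral n α p (fun r => μ (ball x r)) r with hT
  rw [wolffPotential_withDensity]
  calc D⁻¹ ^ τ * 2⁻¹ ^ b * m ^ b = D⁻¹ ^ τ * (2⁻¹ ^ b * m ^ b) := mul_assoc _ _ _
    _ ≤ D⁻¹ ^ τ * ∫⁻ r in Ioi 0, g r * min (T r) m ^ τ := by gcongr
    _ = ∫⁻ r in Ioi 0, D⁻¹ ^ τ * (g r * min (T r) m ^ τ) := (lintegral_const_mul' _ _ hDi).symm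
    _ ≤ _ := by
      refine setLIntegral_mono' measurableSet_Ioi fun r hr => ?_
      -- For y in B(x,r) the tail `T r` at x is at most `D * W y`. The bound `D ≥ 1` handles the
      -- case where the truncation at k is active.
      have hball : μ (ball x r) * (D⁻¹ * min (T r) m) ^ (b * q) ≤
          ∫⁻ y in ball x r, (min (W y) k ^ b) ^ q ∂μ := by
        rw [mul_comm, ← setLIntegral_const]
        refine setLIntegral_mono' measurableSet_ball fun y hy => ?_
        rw [ENNReal.rpow_mul]
        gcongr
        rw [← ENNReal.div_eq_inv_mul]
        refine ENNReal.div_le_of_le_mul ?_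
        have h1 : T r ≤ D * W y :=
          (tailIntegral_measure_ball_le hp (mem_Ioi.1 hr).le (mem_ball'.1 hy).le).trans
            (by gcongr; exact le_max_left _ _)
        have h2 : min (T r) m ≤ D * k :=
          (min_le_right _ _).trans ((min_le_right _ _).trans
            (le_mul_of_one_le_left' (le_max_right _ _)))
        rcases le_total (W y) k with h | h
        · rw [min_eq_left h, mul_comm]; exact (min_le_left _ _).trans h1
        · rw [min_eq_right h, mul_comm]; exact h2
      calc D⁻¹ ^ τ * (g r * min (T r) m ^ τ)
          = (μ (ball x r) * (D⁻¹ * min (T r) m) ^ (b * q) /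
            ENNReal.ofReal (r ^ ((n : ℝ) - α * p))) ^ (1 / (p - 1)) / ENNReal.ofReal r := by
            rw [hg, mul_comm (μ (ball x r)), mul_div_assoc, ENNReal.mul_rpow_of_nonneg _ _ hγ,
              ← ENNReal.rpow_mul, ← hτ, ENNReal.mul_rpow_of_nonneg _ _ hτ0]
            simp only [div_eq_mul_inv]
            ring
        _ ≤ _ := by gcongr

/-- A `σ`-almost everywhere positive supersolution of `u = W_{α,p}(u^q dσ)`. -/
structure IsSupersolution (α p q : ℝ) (μ : Measure (EuclideanSpace ℝ (Fin n)))
    (u : EuclideanSpace ℝ (Fin n) → ℝ≥0∞) : Prop where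
  measurable : Measurable u
  pos : ∀ᵐ x ∂μ, 0 < u x
  le : ∀ x, wolffPotential α p (μ.withDensity fun y => u y ^ q) x ≤ u x

variable {μ σ : Measure (EuclideanSpace ℝ (Fin n))} {u : EuclideanSpace ℝ (Fin n) → ℝ≥0∞}

theorem withDensity_le_withDensity_of_measure_le {X : Type*} [MeasurableSpace X] {μ ν : Measure X} (h : μ ≤ ν)
    (f : X → ℝ≥0∞) : μ.withDensity f ≤ ν.withDensity f := by
  refine Measure.le_iff.2 fun s hs => ?_
  rw [withDensity_apply _ hs, withDensity_apply _ hs]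
  exact lintegral_mono' (Measure.restrict_mono le_rfl h) le_rfl

theorem IsSupersolution.restrict (hp : 1 < p) (h : IsSupersolution α p q μ u)
    (s : Set (EuclideanSpace ℝ (Fin n))) : IsSupersolution α p q (μ.restrict s) u where
  measurable := h.measurable
  pos := ae_restrict_of_ae h.pos
  le := fun x => (wolffPotential_mono_measure hp
    (withDensity_le_withDensity_of_measure_le Measure.restrict_le_self _)).trans (h.le x)

theorem IsSupersolution.withDensity_ne_zero (hq : 0 < q) (h : IsSupersolution α p q μ u)
    (hμ : μ ≠ 0) : μ.withDensity (fun y => u y ^ q) ≠ 0 := by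
  intro h0
  have := (withDensity_eq_zero_iff (h.measurable.pow_const q).aemeasurable).1 h0
  have hF : ∀ᵐ _ ∂μ, False := by
    filter_upwards [this, h.pos] with x hx hx'
    exact ((ENNReal.rpow_eq_zero_iff_of_pos hq).1 hx ▸ hx').false
  have : (ae μ).NeBot := ae_neBot.2 hμ
  exact hF.exists.choose_spec

/-- A positive number that is not smaller than its image under a sublinear power is bounded below. -/
theorem rpow_le_of_mul_rpow_le {δ : ℝ} (hδ1 : δ < 1) {c A : ℝ≥0∞} (hA0 : A ≠ 0)
    (hA : A ≠ ∞) (h : c * A ^ δ ≤ A) : c ^ (1 - δ)⁻¹ ≤ A := by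
  have h1 : 0 < 1 - δ := by linarith
  rw [ENNReal.rpow_inv_le_iff h1, ENNReal.rpow_sub _ _ hA0 hA, ENNReal.rpow_one]
  rwa [ENNReal.le_div_iff_mul_le (Or.inl (ENNReal.rpow_pos hA0.bot_lt hA).ne')
    (Or.inr hA)]

/-- The best constant A in A φ^b ≤ u, capped at c^b, satisfies c A^δ ≤ A by the supersolution
property and homogeneity, so A ≥ c^b as soon as A > 0. Restricting to a ball and truncating φ
secures A > 0; both are then removed by monotone limits. -/
theorem exists_le_supersolution (n : ℕ) (α : ℝ) (hp : 1 < p) (hq : 0 < q) (hqp : q < p - 1) :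
    ∃ c : ℝ≥0∞, c ≠ 0 ∧ c ≠ ∞ ∧ ∀ (μ : Measure (EuclideanSpace ℝ (Fin n))) [SFinite μ]
      (u : EuclideanSpace ℝ (Fin n) → ℝ≥0∞), IsSupersolution α p q μ u →
      ∀ x, c * wolffPotential α p μ x ^ ((p - 1) / (p - 1 - q)) ≤ u x := by
  obtain ⟨c, hc0, hct, hc⟩ := exists_le_wolffPotential_min n α hp hq hqp
  have hp1 : 0 < p - 1 := by linarith
  have hpq : 0 < p - 1 - q := by linarith
  have hγ : 0 ≤ 1 / (p - 1) := by positivity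
  set b := (p - 1) / (p - 1 - q) with hb
  have hb0 : 0 < b := by positivity
  set δ := q / (p - 1) with hδ
  have hδ0 : 0 < δ := by positivity
  have hδ1 : δ < 1 := by rw [hδ, div_lt_one hp1]; exact hqp
  have hδb : (1 - δ)⁻¹ = b := by rw [hδ, hb]; field_simp
  have hδb' : 1 + b * δ = b := by rw [hδ, hb]; field_simp; ring
  have hcb0 : c ^ b ≠ 0 := (ENNReal.rpow_pos hc0.bot_lt hct).ne'
  have hcbt : c ^ b ≠ ∞ := (ENNReal.rpow_lt_top_of_nonneg hb0.le hct).ne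
  refine ⟨c ^ b, hcb0, hcbt, fun μ _ u hu x => ?_⟩
  have main : ∀ (R : ℕ) (k : ℕ), c ^ b *
      min (wolffPotential α p (μ.restrict (ball 0 R)) x) k ^ b ≤ u x := by
    intro R k
    set μR := μ.restrict (ball 0 R) with hμR
    set φ : EuclideanSpace ℝ (Fin n) → ℝ≥0∞ := fun y => min (wolffPotential α p μR y) k with hφ
    have hφm : Measurable φ := measurable_wolffPotential.min measurable_const
    by_cases hμ0 : μ = 0
    · simp [hμR, hμ0, wolffPotential_zero_measure hp, hb0]
    -- The cap c^b keeps the supremum finite and is preserved by a ↦ c a^δ, of which it is the fixed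
    -- point. Testing on the ball suffices because `μR` lives there, yet `step` then holds at every
    -- point.
    set S : Set ℝ≥0∞ := {a | a ≤ c ^ b ∧ ∀ y ∈ ball (0 : EuclideanSpace ℝ (Fin n)) R,
      a * φ y ^ b ≤ u y} with hS
    have step : ∀ a ∈ S, ∀ y, c * a ^ δ * φ y ^ b ≤ u y := by
      intro a ha y
      calc c * a ^ δ * φ y ^ b = a ^ δ * (c * φ y ^ b) := by ring
        _ ≤ a ^ δ * wolffPotential α p (μR.withDensity fun y => (φ y ^ b) ^ q) y := by
            gcongr; exact hc μR k (by simp) y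
        _ = wolffPotential α p (μR.withDensity fun y => a ^ q * (φ y ^ b) ^ q) y := by
            rw [wolffPotential_withDensity_const_mul hp _ ((hφm.pow_const _).pow_const _),
              ← ENNReal.rpow_mul]
            congr 2
            rw [hδ]; ring
        _ ≤ wolffPotential α p (μR.withDensity fun y => u y ^ q) y := by
            refine wolffPotential_withDensity_mono hp ?_
            filter_upwards [ae_restrict_mem measurableSet_ball] with z hz
            rw [← ENNReal.mul_rpow_of_nonneg _ _ hq.le]
            gcongr
            exact ha.2 z hz
        _ ≤ u y := (hu.restrict hp _).le y
    have hA : sSup S ∈ S := by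
      refine ⟨sSup_le fun a ha => ha.1, fun y hy => ?_⟩
      rw [sSup_eq_iSup', ENNReal.iSup_mul]
      exact iSup_le fun a => a.2.2 y hy
    have hApos : sSup S ≠ 0 := by
      obtain ⟨m, hm, hmle⟩ := exists_pos_le_wolffPotential (α := α) hp
        (hu.withDensity_ne_zero hq hμ0) R
      have hkb : (k : ℝ≥0∞) ^ b ≠ ∞ := (ENNReal.rpow_lt_top_of_nonneg hb0.le (by simp)).ne
      have h1 : min (c ^ b) (m / k ^ b) ∈ S := by
        refine ⟨min_le_left _ _, fun y hy => ?_⟩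
        calc min (c ^ b) (m / k ^ b) * φ y ^ b ≤ m / k ^ b * k ^ b := by
              gcongr
              · exact min_le_right _ _
              · exact min_le_right _ _
          _ ≤ m := ENNReal.mul_le_of_le_div le_rfl
          _ ≤ u y := (hmle y hy).trans (hu.le y)
      have h2 : 0 < min (c ^ b) (m / k ^ b) :=
        lt_min hcb0.bot_lt (ENNReal.div_pos hm.ne' hkb)
      exact (h2.trans_le (le_sSup h1)).ne'
    have hAt : sSup S ≠ ∞ := ne_top_of_le_ne_top hcbt hA.1
    have hmem : c * sSup S ^ δ ∈ S := by
      refine ⟨?_, fun y _ => step _ hA y⟩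
      calc c * sSup S ^ δ ≤ c * (c ^ b) ^ δ := by gcongr; exact hA.1
        _ = c ^ b := by
          rw [← ENNReal.rpow_mul, ← hδb', ENNReal.rpow_add _ _ hc0 hct, ENNReal.rpow_one, hδb']
    have hle := rpow_le_of_mul_rpow_le hδ1 hApos hAt (le_sSup hmem)
    rw [hδb] at hle
    refine le_trans ?_ (step _ hA x)
    gcongr
    calc c ^ b = c * (c ^ b) ^ δ := by
          rw [← ENNReal.rpow_mul]
          conv_lhs => rw [← hδb', ENNReal.rpow_add _ _ hc0 hct, ENNReal.rpow_one]
      _ ≤ _ := by gcongr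
  -- Written as an upper bound on Y, the estimate passes to the suprema over k and R.
  have conv : ∀ Y : ℝ≥0∞, c ^ b * Y ^ b ≤ u x ↔ Y ≤ (u x / c ^ b) ^ b⁻¹ := by
    intro Y
    rw [ENNReal.le_rpow_inv_iff hb0, ENNReal.le_div_iff_mul_le (Or.inl hcb0) (Or.inl hcbt),
      mul_comm]
  rw [conv, wolffPotential_eq_iSup_restrict hp]
  refine iSup_le fun R => ?_
  have : wolffPotential α p (μ.restrict (ball 0 R)) x =
      ⨆ k : ℕ, min (wolffPotential α p (μ.restrict (ball 0 R)) x) k := by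
    rw [← inf_iSup_eq, ENNReal.iSup_natCast, inf_top_eq]
  rw [this]
  exact iSup_le fun k => (conv _).1 (main R k)

end Lower

/-! ### The constant κ and the mass of supersolutions. -/

section Kappa

variable {n : ℕ} {α p q : ℝ} {σ ν : Measure (EuclideanSpace ℝ (Fin n))}

theorem kappa_mono (hq : 0 < q) : Monotone (kappa α p q σ) := by
  intro E F hEF
  refine sInf_le_sInf fun c hc ν hν => le_trans ?_ (hc ν hν)
  have : 0 ≤ 1 / q := by positivity
  gcongr

theorem kappa_rpow_mono (hq : 0 < q) {s : ℝ} (hs : 0 ≤ s) :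
    Monotone fun E => kappa α p q σ E ^ s :=
  fun _ _ h => ENNReal.rpow_le_rpow (kappa_mono hq h) hs

theorem kappa_eq_zero (hq : 0 < q) {E : Set (EuclideanSpace ℝ (Fin n))} (hE : σ E = 0) :
    kappa α p q σ E = 0 := by
  refine le_antisymm (sInf_le fun ν _ => ?_) zero_le
  have hq' : 0 < 1 / q := by positivity
  rw [setLIntegral_measure_zero _ _ hE, ENNReal.zero_rpow_of_pos hq']
  exact zero_le

/-- The infimum defining κ may be used as an admissible constant: for ν finite and nonzero one
divides by the power of its mass. -/
theorem lintegral_wolffPotential_rpow_le_kappa (hp : 1 < p) (hq : 0 < q)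
    {E : Set (EuclideanSpace ℝ (Fin n))} [IsFiniteMeasure ν] :
    ∫⁻ y in E, wolffPotential α p ν y ^ q ∂σ ≤
      kappa α p q σ E ^ q * ν univ ^ (q / (p - 1)) := by
  have hp1 : 0 < p - 1 := by linarith
  have hγ : 0 < 1 / (p - 1) := by positivity
  rcases eq_or_ne ν 0 with rfl | hν
  · simp only [wolffPotential_zero_measure hp, ENNReal.zero_rpow_of_pos hq, lintegral_zero,
      zero_le]
  set X := ∫⁻ y in E, wolffPotential α p ν y ^ q ∂σ with hX
  set M := ν univ ^ (1 / (p - 1)) with hM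
  have hν0 : ν univ ≠ 0 := fun h => hν (Measure.measure_univ_eq_zero.1 h)
  have hM0 : M ≠ 0 := (ENNReal.rpow_pos hν0.bot_lt (measure_ne_top _ _)).ne'
  have hMt : M ≠ ∞ := (ENNReal.rpow_lt_top_of_nonneg hγ.le (measure_ne_top _ _)).ne
  have h1 : X ^ (1 / q) / M ≤ kappa α p q σ E := by
    refine le_sInf fun c hc => ?_
    exact ENNReal.div_le_of_le_mul (hc ν inferInstance)
  have h2 : X ^ (1 / q) ≤ kappa α p q σ E * M :=
    (ENNReal.div_le_iff_le_mul (Or.inl hM0) (Or.inl hMt)).1 h1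
  calc X = (X ^ (1 / q)) ^ q := by
        rw [← ENNReal.rpow_mul, one_div, inv_mul_cancel₀ hq.ne', ENNReal.rpow_one]
    _ ≤ (kappa α p q σ E * M) ^ q := by gcongr
    _ = _ := by
        rw [ENNReal.mul_rpow_of_nonneg _ _ hq.le, hM, ← ENNReal.rpow_mul]
        congr 2
        ring

/-- The mass of a supersolution controls the constant `κ`. -/
theorem exists_kappa_rpow_le (n : ℕ) (α : ℝ) (hp : 1 < p) (hq : 0 < q) (hqp : q < p - 1) :
    ∃ C : ℝ≥0∞, C ≠ 0 ∧ C ≠ ∞ ∧ ∀ (σ : Measure (EuclideanSpace ℝ (Fin n)))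
      (E : Set (EuclideanSpace ℝ (Fin n))) (u : EuclideanSpace ℝ (Fin n) → ℝ≥0∞),
      IsSupersolution α p q (σ.restrict E) u →
      kappa α p q σ E ^ (q * (p - 1) / (p - 1 - q)) ≤ C * ∫⁻ y in E, u y ^ q ∂σ := by
  have hp1 : 0 < p - 1 := by linarith
  have hpq : 0 < p - 1 - q := by linarith
  have hγ : 0 < 1 / (p - 1) := by positivity
  have hs0 : 0 < q * (p - 1) / (p - 1 - q) := by positivity
  set b := (p - 1) / (p - 1 - q) with hb
  have hb0 : 0 < b := by positivity
  set δ := q / (p - 1) with hδ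
  have hδ0 : 0 < δ := by positivity
  have hδ1 : δ < 1 := by rw [hδ, div_lt_one hp1]; exact hqp
  have hδb : (1 - δ) * b = 1 := by rw [hδ, hb]; field_simp
  obtain ⟨N, hN⟩ := exists_weakType_const n
  obtain ⟨K, hK0, hKt, hK⟩ := exists_lintegral_rpow_le_of_weakType hδ0 hδ1
  set N' : ℝ≥0∞ := max N 1 with hN'
  have hN'0 : N' ≠ 0 := by simp [hN']
  have hN't : N' ≠ ∞ := by simp [hN']
  set C₁ := K * N' ^ δ with hC₁
  have hC₁0 : C₁ ≠ 0 := mul_ne_zero hK0 (ENNReal.rpow_pos hN'0.bot_lt hN't).ne'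
  have hC₁t : C₁ ≠ ∞ := ENNReal.mul_ne_top hKt (ENNReal.rpow_lt_top_of_nonneg hδ0.le hN't).ne
  have hC0 : C₁ ^ b ≠ 0 := (ENNReal.rpow_pos hC₁0.bot_lt hC₁t).ne'
  refine ⟨C₁ ^ b, hC0, (ENNReal.rpow_lt_top_of_nonneg hb0.le hC₁t).ne, fun σ E u hu => ?_⟩
  set μ := σ.restrict E with hμ
  set m := ∫⁻ y in E, u y ^ q ∂σ with hm
  have humq : Measurable fun y => u y ^ q := hu.measurable.pow_const q
  rcases eq_or_ne m ∞ with hmt | hmt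
  · rw [hmt, ENNReal.mul_top hC0]; exact le_top
  rcases eq_or_ne m 0 with hm0 | hm0
  · have h1 := (lintegral_eq_zero_iff humq).1 hm0
    have h2 : ∀ᵐ _ ∂μ, False := by
      filter_upwards [h1, hu.pos] with x hx hx'
      exact ((ENNReal.rpow_eq_zero_iff_of_pos hq).1 hx ▸ hx').false
    have h3 : σ E = 0 := by
      rw [Filter.eventually_false_iff_eq_bot, ae_eq_bot] at h2
      rw [← Measure.restrict_eq_zero, ← hμ, h2]
    rw [kappa_eq_zero hq h3, ENNReal.zero_rpow_of_pos hs0]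
    exact zero_le
  set ω := μ.withDensity fun y => u y ^ q with hω
  have hωm : ω univ = m := by rw [hω, withDensity_apply _ MeasurableSet.univ, setLIntegral_univ]
  have hut : ∀ᵐ x ∂μ, u x ^ q < ∞ := ae_lt_top humq hmt
  have hm1 : C₁ * m ^ (1 - δ) ≠ 0 :=
    mul_ne_zero hC₁0 (ENNReal.rpow_pos hm0.bot_lt hmt).ne'
  have hκ : kappa α p q σ E ≤ (C₁ * m ^ (1 - δ)) ^ (1 / q) := by
    refine sInf_le fun ν hν => ?_
    have hq' : 0 < 1 / q := by positivity
    rcases eq_or_ne (ν univ) ∞ with hνt | hνt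
    · rw [hνt, ENNReal.top_rpow_of_pos hγ, ENNReal.mul_top]
      · exact le_top
      · rw [Ne, ENNReal.rpow_eq_zero_iff_of_pos hq']; exact hm1
    rcases eq_or_ne ν 0 with rfl | hν0
    · simp only [wolffPotential_zero_measure hp, ENNReal.zero_rpow_of_pos hq, lintegral_zero,
        ENNReal.zero_rpow_of_pos hq', zero_le]
    have hν0' : ν univ ≠ 0 := fun h => hν0 (Measure.measure_univ_eq_zero.1 h)
    -- With this power h^δ = (Wν/u)^q, so integrating against ω = u^q dμ cancels the density and
    -- leaves (Wν)^q.
    set h : EuclideanSpace ℝ (Fin n) → ℝ≥0∞ :=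
      fun x => (wolffPotential α p ν x / u x) ^ (p - 1) with hh
    have hhm : Measurable h := (measurable_wolffPotential.div hu.measurable).pow_const _
    -- If ν ≤ lω on all balls centred at x, then Wν ≤ l^(1/(p-1)) Wω ≤ l^(1/(p-1)) u at x, that is,
    -- h ≤ l.
    have hweak : ∀ l : ℝ≥0∞, l ≠ 0 → l ≠ ∞ → l * ω {x | l < h x} ≤ N' * ν univ := by
      intro l _ _
      calc l * ω {x | l < h x}
          ≤ l * ω {x | ∃ r : ℝ, 0 < r ∧ l * ω (ball x r) < ν (ball x r)} := by
            gcongr with x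
            intro hx
            by_contra! hcon
            have h1 := (wolffPotential_le_of_forall_ball_le (α := α) hp hcon).trans
              (mul_le_mul_right (hu.le x) _)
            have h2 := ENNReal.div_le_of_le_mul h1
            rw [one_div, ENNReal.le_rpow_inv_iff hp1] at h2
            exact absurd hx (not_lt.2 h2)
        _ ≤ N * ν univ := hN ω ν l
        _ ≤ N' * ν univ := by gcongr; exact le_max_left _ _
    have hmain := hK ω h (N' * ν univ) (mul_ne_zero hN'0 hν0') (ENNReal.mul_ne_top hN't hνt)
      (hωm ▸ hm0) (hωm ▸ hmt) hhm hweak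
    have hint : ∫⁻ y in E, wolffPotential α p ν y ^ q ∂σ = ∫⁻ x, h x ^ δ ∂ω := by
      rw [hω, lintegral_withDensity_eq_lintegral_mul _ humq (hhm.pow_const _)]
      refine lintegral_congr_ae ?_
      filter_upwards [hut, hu.pos] with x hx hx'
      have hx1 : u x ≠ ∞ := fun h => by simp [h, hq] at hx
      rw [Pi.mul_apply, hh]
      dsimp only
      rw [← ENNReal.rpow_mul, show (p - 1) * δ = q by rw [hδ]; field_simp,
        ← ENNReal.mul_rpow_of_nonneg _ _ hq.le, ENNReal.mul_div_cancel hx'.ne' hx1]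
    have hνp : (ν univ ^ (1 / (p - 1))) = (ν univ ^ δ) ^ (1 / q) := by
      rw [← ENNReal.rpow_mul]
      congr 1
      rw [hδ]; field_simp
    rw [hνp, ← ENNReal.mul_rpow_of_nonneg _ _ hq'.le, hint]
    gcongr
    refine hmain.trans_eq ?_
    rw [hωm, ENNReal.mul_rpow_of_nonneg _ _ hδ0.le, hC₁]
    ring
  calc kappa α p q σ E ^ (q * (p - 1) / (p - 1 - q))
      ≤ ((C₁ * m ^ (1 - δ)) ^ (1 / q)) ^ (q * (p - 1) / (p - 1 - q)) := by gcongr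
    _ = C₁ ^ b * m := by
      rw [← ENNReal.rpow_mul, show 1 / q * (q * (p - 1) / (p - 1 - q)) = b by rw [hb]; field_simp,
        ENNReal.mul_rpow_of_nonneg _ _ hb0.le, ← ENNReal.rpow_mul, hδb, ENNReal.rpow_one]

end Kappa

/-! ### Monotone iteration and supersolutions of controlled mass. -/

section Iteration

variable {n : ℕ} {α p q : ℝ}

/-- An increasing sequence of iterates that starts from a small bounded subsolution. -/
theorem exists_iteration (n : ℕ) (α : ℝ) (hp : 1 < p) (hq : 0 < q) (hqp : q < p - 1) :
    ∃ C : ℝ≥0∞, C ≠ ∞ ∧ ∀ (μ : Measure (EuclideanSpace ℝ (Fin n))) [SFinite μ],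
      ∃ f : ℕ → EuclideanSpace ℝ (Fin n) → ℝ≥0∞,
        (∀ k, Measurable (f k)) ∧ Monotone f ∧
        (∀ k x, f (k + 1) x = wolffPotential α p (μ.withDensity fun y => f k y ^ q) x) ∧
        (∀ x, f 0 x ≤ C) ∧
        (∀ x, f 0 x ≤ C * wolffPotential α p μ x ^ ((p - 1) / (p - 1 - q))) ∧
        (μ ≠ 0 → ∀ x, 0 < f 0 x) := by
  obtain ⟨c, hc0, hct, hc⟩ := exists_le_wolffPotential_min n α hp hq hqp
  have hp1 : 0 < p - 1 := by linarith
  have hpq : 0 < p - 1 - q := by linarith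
  set b := (p - 1) / (p - 1 - q) with hb
  have hb0 : 0 < b := by positivity
  have hγ : 0 ≤ 1 / (p - 1) := by positivity
  set δ := q / (p - 1) with hδ
  have hδb' : 1 + b * δ = b := by rw [hδ, hb]; field_simp; ring
  have hcbt : c ^ b ≠ ∞ := (ENNReal.rpow_lt_top_of_nonneg hb0.le hct).ne
  refine ⟨c ^ b, hcbt, fun μ _ => ?_⟩
  -- Truncation at 1 keeps the starting function bounded, so its integrals are finite on finite
  -- measures. The factor c^b is the fixed point of a ↦ c a^δ, which makes `f 0` a subsolution.
  set φ : EuclideanSpace ℝ (Fin n) → ℝ≥0∞ := fun y => min (wolffPotential α p μ y) 1 with hφ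
  have hφm : Measurable φ := measurable_wolffPotential.min measurable_const
  set f : ℕ → EuclideanSpace ℝ (Fin n) → ℝ≥0∞ := fun k => k.rec (fun y => c ^ b * φ y ^ b)
    fun _ g x => wolffPotential α p (μ.withDensity fun y => g y ^ q) x with hf
  have hsucc : ∀ k x, f (k + 1) x = wolffPotential α p (μ.withDensity fun y => f k y ^ q) x :=
    fun k x => rfl
  have hmeas : ∀ k, Measurable (f k) := by
    intro k
    cases k with
    | zero => exact (hφm.pow_const b).const_mul _
    | succ k =>
      have : f (k + 1) = wolffPotential α p (μ.withDensity fun y => f k y ^ q) := rfl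
      rw [this]
      exact measurable_wolffPotential
  refine ⟨f, hmeas, monotone_nat_of_le_succ fun k => ?_, hsucc, fun x => ?_, fun x => ?_,
    fun hμ x => ?_⟩
  · induction k with
    | zero =>
      intro x
      rw [hsucc]
      have h1 : (fun y => f 0 y ^ q) = fun y => (c ^ b) ^ q * (φ y ^ b) ^ q := by
        ext y
        exact ENNReal.mul_rpow_of_nonneg _ _ hq.le
      rw [h1, wolffPotential_withDensity_const_mul hp _ ((hφm.pow_const _).pow_const _)]
      calc c ^ b * φ x ^ b = (c ^ b) ^ δ * (c * φ x ^ b) := by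
            rw [← ENNReal.rpow_mul]
            conv_lhs => rw [← hδb', ENNReal.rpow_add _ _ hc0 hct, ENNReal.rpow_one, hδb']
            ring
        _ ≤ ((c ^ b) ^ q) ^ (1 / (p - 1)) *
            wolffPotential α p (μ.withDensity fun y => (φ y ^ b) ^ q) x := by
            rw [← ENNReal.rpow_mul (c ^ b), show q * (1 / (p - 1)) = δ by rw [hδ]; ring]
            gcongr
            exact hc μ 1 (by simp) x
    | succ k ih =>
      intro x
      change wolffPotential α p (μ.withDensity fun y => f k y ^ q) x ≤
        wolffPotential α p (μ.withDensity fun y => f (k + 1) y ^ q) x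
      refine wolffPotential_withDensity_mono hp (Filter.Eventually.of_forall fun y => ?_)
      exact ENNReal.rpow_le_rpow (ih y) hq.le
  · calc c ^ b * φ x ^ b ≤ c ^ b * 1 ^ b := by gcongr; exact min_le_right _ _
      _ = c ^ b := by simp
  · change c ^ b * φ x ^ b ≤ _
    gcongr
    exact min_le_left _ _
  · have h1 : 0 < φ x := lt_min (wolffPotential_pos hp hμ x) one_pos
    exact ENNReal.mul_pos (ENNReal.rpow_pos hc0.bot_lt hct).ne'
      (ENNReal.rpow_pos h1 (ne_top_of_le_ne_top (by simp) (min_le_right _ _))).ne'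

theorem rpow_iSup {ι : Type*} (f : ι → ℝ≥0∞) {s : ℝ} (hs : 0 < s) :
    (⨆ i, f i) ^ s = ⨆ i, f i ^ s :=
  (ENNReal.orderIsoRpow s hs).map_iSup f

theorem lintegral_iSup_rpow {X : Type*} [MeasurableSpace X] {μ : Measure X} {s : ℝ} (hs : 0 < s)
    {f : ℕ → X → ℝ≥0∞} (hf : ∀ k, Measurable (f k)) (hmono : Monotone f) :
    ∫⁻ x, (⨆ k, f k x) ^ s ∂μ = ⨆ k, ∫⁻ x, f k x ^ s ∂μ := by
  simp_rw [rpow_iSup _ hs]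
  exact lintegral_iSup (fun k => (hf k).pow_const s)
    fun i j hij x => ENNReal.rpow_le_rpow (hmono hij x) hs.le

theorem iSup_iteration_eq (hp : 1 < p) (hq : 0 < q) {μ : Measure (EuclideanSpace ℝ (Fin n))}
    {f : ℕ → EuclideanSpace ℝ (Fin n) → ℝ≥0∞} (hf : ∀ k, Measurable (f k)) (hmono : Monotone f)
    (hsucc : ∀ k x, f (k + 1) x = wolffPotential α p (μ.withDensity fun y => f k y ^ q) x)
    (x : EuclideanSpace ℝ (Fin n)) :
    ⨆ k, f k x = wolffPotential α p (μ.withDensity fun y => (⨆ k, f k y) ^ q) x := by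
  simp_rw [rpow_iSup _ hq]
  rw [wolffPotential_withDensity_iSup hp (fun k => (hf k).pow_const q)
    fun i j hij y => ENNReal.rpow_le_rpow (hmono hij y) hq.le]
  simp_rw [← hsucc]
  have : Monotone fun k => f k x := fun i j hij => hmono hij x
  exact (this.iSup_nat_add 1).symm

theorem isSupersolution_iSup (hp : 1 < p) (hq : 0 < q)
    {μ : Measure (EuclideanSpace ℝ (Fin n))}
    {f : ℕ → EuclideanSpace ℝ (Fin n) → ℝ≥0∞} (hf : ∀ k, Measurable (f k)) (hmono : Monotone f)
    (hsucc : ∀ k x, f (k + 1) x = wolffPotential α p (μ.withDensity fun y => f k y ^ q) x)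
    (hpos : μ ≠ 0 → ∀ x, 0 < f 0 x) : IsSupersolution α p q μ fun x => ⨆ k, f k x where
  measurable := Measurable.iSup hf
  pos := by
    rcases eq_or_ne μ 0 with rfl | hμ
    · simp
    · exact Filter.Eventually.of_forall fun x => (hpos hμ x).trans_le (le_iSup (fun k => f k x) 0)
  le := fun x => (iSup_iteration_eq hp hq hf hmono hsucc x).ge

/-- The bound is the fixed point of t ↦ A t^δ. The base case combines I 0 ≤ I 1 ≤ A (I 0)^δ with
finiteness of I 0; finiteness of later terms comes along with the induction. -/
theorem le_rpow_of_sublinear_recursion {δ : ℝ} (hδ0 : 0 < δ) (hδ1 : δ < 1) {I : ℕ → ℝ≥0∞}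
    {A : ℝ≥0∞} (hA : A ≠ ∞) (h0 : I 0 ≠ ∞) (h01 : I 0 ≤ I 1)
    (hI : ∀ k, I k ≠ ∞ → I (k + 1) ≤ A * I k ^ δ) (k : ℕ) : I k ≤ A ^ (1 - δ)⁻¹ := by
  have h1 : 0 < 1 - δ := by linarith
  have hAt : A ^ (1 - δ)⁻¹ ≠ ∞ := (ENNReal.rpow_lt_top_of_nonneg (by positivity) hA).ne
  have hfix : A * (A ^ (1 - δ)⁻¹) ^ δ = A ^ (1 - δ)⁻¹ := by
    rcases eq_or_ne A 0 with rfl | hA0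
    · rw [zero_mul, ENNReal.zero_rpow_of_pos (by positivity)]
    · rw [← ENNReal.rpow_mul]
      conv_lhs => rw [← ENNReal.rpow_one A, ← ENNReal.rpow_mul, ← ENNReal.rpow_add _ _ hA0 hA]
      congr 1
      field_simp
      ring
  induction k with
  | zero =>
    rcases eq_or_ne (I 0) 0 with h | h
    · rw [h]; exact zero_le
    · rw [ENNReal.le_rpow_inv_iff h1, ENNReal.rpow_sub _ _ h h0, ENNReal.rpow_one]
      exact ENNReal.div_le_of_le_mul (h01.trans (hI 0 h0))
  | succ k ih =>
    calc I (k + 1) ≤ A * I k ^ δ := hI k (ne_top_of_le_ne_top hAt ih)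
      _ ≤ A * (A ^ (1 - δ)⁻¹) ^ δ := by gcongr
      _ = _ := hfix

/-- If `κ(E)` is finite then there is a solution for the restriction of `σ` to `E` with controlled
mass. -/
theorem exists_supersolution_lintegral_le_kappa (hp : 1 < p) (hq : 0 < q) (hqp : q < p - 1)
    {σ : Measure (EuclideanSpace ℝ (Fin n))} {E : Set (EuclideanSpace ℝ (Fin n))}
    (hσE : σ E ≠ ∞) (hκ : kappa α p q σ E ≠ ∞) :
    ∃ u, IsSupersolution α p q (σ.restrict E) u ∧
      ∫⁻ y in E, u y ^ q ∂σ ≤ kappa α p q σ E ^ (q * (p - 1) / (p - 1 - q)) := by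
  have hp1 : 0 < p - 1 := by linarith
  have hpq : 0 < p - 1 - q := by linarith
  obtain ⟨C, hC, hit⟩ := exists_iteration n α hp hq hqp
  set μ := σ.restrict E with hμ
  have : IsFiniteMeasure μ := ⟨by rw [hμ, Measure.restrict_apply_univ]; exact hσE.lt_top⟩
  obtain ⟨f, hfm, hmono, hsucc, hC0, -, hpos⟩ := hit μ
  refine ⟨_, isSupersolution_iSup hp hq hfm hmono hsucc hpos, ?_⟩
  rw [lintegral_iSup_rpow hq hfm hmono]
  refine iSup_le fun k => ?_
  have hδ : q * (1 - q / (p - 1))⁻¹ = q * (p - 1) / (p - 1 - q) := by field_simp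
  rw [← hδ, ENNReal.rpow_mul]
  refine le_rpow_of_sublinear_recursion (δ := q / (p - 1)) (I := fun k => ∫⁻ y, f k y ^ q ∂μ)
    (by positivity) ((div_lt_one hp1).2 hqp)
    (ENNReal.rpow_lt_top_of_nonneg hq.le hκ).ne ?_ ?_ (fun k hk => ?_) k
  · refine ne_top_of_le_ne_top ?_ (lintegral_mono fun y => ENNReal.rpow_le_rpow (hC0 y) hq.le)
    rw [lintegral_const]
    exact ENNReal.mul_ne_top (ENNReal.rpow_lt_top_of_nonneg hq.le hC).ne (measure_ne_top _ _)
  · exact lintegral_mono fun y => ENNReal.rpow_le_rpow (hmono zero_le_one y) hq.le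
  -- Testing the inequality for κ on the measure f_k^q dμ gives the recursion with exponent δ.
  · have : IsFiniteMeasure (μ.withDensity fun y => f k y ^ q) := isFiniteMeasure_withDensity hk
    simp_rw [hsucc]
    refine (lintegral_wolffPotential_rpow_le_kappa hp hq).trans_eq ?_
    rw [withDensity_apply _ MeasurableSet.univ, setLIntegral_univ]

end Iteration

/-! ### Strong type estimate and solutions of finite energy. -/

section Energy

variable {n : ℕ} {α p q : ℝ}

/-- The strong type estimate for the quotient of two Wolff potentials, which is dominated by a
centred maximal function. -/
theorem exists_lintegral_wolffPotential_div_rpow_le (n : ℕ) (α : ℝ) (hp : 1 < p) {r : ℝ}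
    (hr : 1 < r) :
    ∃ C : ℝ≥0∞, C ≠ ∞ ∧ ∀ (μ : Measure (EuclideanSpace ℝ (Fin n))) [IsFiniteMeasure μ]
      (f : EuclideanSpace ℝ (Fin n) → ℝ≥0∞), Measurable f → ∫⁻ x, f x ^ r ∂μ ≠ ∞ →
      ∫⁻ x, ((wolffPotential α p (μ.withDensity f) x / wolffPotential α p μ x) ^ (p - 1)) ^ r ∂μ ≤
        C * ∫⁻ x, f x ^ r ∂μ := by
  have hp1 : 0 < p - 1 := by linarith
  have hr0 : 0 < r := by linarith
  have hr1 : 0 < r - 1 := by linarith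
  obtain ⟨N, hN⟩ := exists_weakType_const n
  have h2r : (2 : ℝ≥0∞) ^ (r - 1) ≠ ∞ := (ENNReal.rpow_lt_top_of_nonneg hr1.le (by simp)).ne
  have hri : (ENNReal.ofReal (r - 1))⁻¹ ≠ ∞ := by simpa using hr
  refine ⟨ENNReal.ofReal r * (2 * N) * ((ENNReal.ofReal (r - 1))⁻¹ * 2 ^ (r - 1)),
    by finiteness, fun μ _ f hf hfr => ?_⟩
  set ν := μ.withDensity f with hν
  set h : EuclideanSpace ℝ (Fin n) → ℝ≥0∞ :=
    fun x => (wolffPotential α p ν x / wolffPotential α p μ x) ^ (p - 1) with hh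
  have hhm : Measurable h := (measurable_wolffPotential.div measurable_wolffPotential).pow_const _
  have hft : ∀ᵐ x ∂μ, f x < ∞ := by
    filter_upwards [ae_lt_top (hf.pow_const r) hfr] with x hx
    by_contra! hc
    rw [top_le_iff.1 hc, ENNReal.top_rpow_of_pos hr0] at hx
    exact hx.ne rfl
  have hνt : ν univ ≠ ∞ := by
    rw [hν, withDensity_apply _ MeasurableSet.univ, setLIntegral_univ]
    have : ∫⁻ x, f x ∂μ ≤ ∫⁻ x, (1 + f x ^ r) ∂μ := by
      refine lintegral_mono fun x => ?_
      rcases le_total (f x) 1 with h | h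
      · exact h.trans le_self_add
      · refine le_trans ?_ le_add_self
        conv_lhs => rw [← ENNReal.rpow_one (f x)]
        exact ENNReal.rpow_le_rpow_of_exponent_le h hr.le
    refine ne_top_of_le_ne_top ?_ this
    rw [lintegral_add_left measurable_const, lintegral_const]
    finiteness
  -- Marcinkiewicz splitting: the part of ν where f ≤ t/2 has average at most t/2, so an average
  -- above t forces the part on `F` to have average above t/2.
  have hweak : ∀ t : ℝ, 0 < t → ENNReal.ofReal t * μ {x | ENNReal.ofReal t < h x} ≤
      2 * N * ν {x | ENNReal.ofReal (t / 2) < f x} := by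
    intro t ht
    set F := {x | ENNReal.ofReal (t / 2) < f x} with hF
    have hFm : MeasurableSet F := measurableSet_lt measurable_const hf
    have ht2 : ENNReal.ofReal t = 2 * ENNReal.ofReal (t / 2) := by
      rw [← ENNReal.ofReal_ofNat 2, ← ENNReal.ofReal_mul zero_le_two]
      congr 1; ring
    have hsub : {x | ENNReal.ofReal t < h x} ⊆ {x | ∃ s : ℝ, 0 < s ∧
        ENNReal.ofReal (t / 2) * μ (ball x s) < ν.restrict F (ball x s)} := by
      intro x hx
      by_contra! hcon
      have hball : ∀ s, 0 < s → ν (ball x s) ≤ ENNReal.ofReal t * μ (ball x s) := by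
        intro s hs
        have h1 : ν.restrict F (ball x s) ≤ ENNReal.ofReal (t / 2) * μ (ball x s) := by
          by_contra! hlt
          exact hcon ⟨s, hs, hlt⟩
        rw [Measure.restrict_apply measurableSet_ball] at h1
        have h2 : ν (ball x s \ F) ≤ ENNReal.ofReal (t / 2) * μ (ball x s) := by
          rw [hν, withDensity_apply _ (measurableSet_ball.diff hFm)]
          calc ∫⁻ y in ball x s \ F, f y ∂μ
              ≤ ∫⁻ _y in ball x s \ F, ENNReal.ofReal (t / 2) ∂μ :=
                setLIntegral_mono' (measurableSet_ball.diff hFm) fun y hy => not_lt.1 hy.2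
            _ = ENNReal.ofReal (t / 2) * μ (ball x s \ F) := setLIntegral_const _ _
            _ ≤ _ := by gcongr; exact sdiff_subset
        rw [← measure_inter_add_sdiff (ball x s) hFm, ht2, two_mul, add_mul]
        exact add_le_add h1 h2
      have h1 := wolffPotential_le_of_forall_ball_le (α := α) hp hball
      have h2 := ENNReal.div_le_of_le_mul h1
      rw [one_div, ENNReal.le_rpow_inv_iff hp1] at h2
      exact absurd hx (not_lt.2 h2)
    calc ENNReal.ofReal t * μ {x | ENNReal.ofReal t < h x}
        ≤ 2 * ENNReal.ofReal (t / 2) * μ {x | ∃ s : ℝ, 0 < s ∧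
          ENNReal.ofReal (t / 2) * μ (ball x s) < ν.restrict F (ball x s)} :=
          mul_le_mul' ht2.le (measure_mono hsub)
      _ = 2 * (ENNReal.ofReal (t / 2) * μ {x | ∃ s : ℝ, 0 < s ∧
          ENNReal.ofReal (t / 2) * μ (ball x s) < ν.restrict F (ball x s)}) := mul_assoc _ _ _
      _ ≤ 2 * (N * ν.restrict F univ) := by gcongr 2 * ?_; exact hN μ _ _
      _ = 2 * N * ν F := by rw [Measure.restrict_apply_univ, mul_assoc]
  -- The layer cake formula is real-valued; t → ∞ in the weak estimate shows that nothing is lost by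
  -- `toReal`.
  have hht : ∀ᵐ x ∂μ, h x < ∞ := by
    have hle : ∀ t : ℝ, 0 < t → μ {x | h x = ∞} ≤ 2 * N * ν univ / ENNReal.ofReal t := by
      intro t ht
      rw [ENNReal.le_div_iff_mul_le (Or.inl (by simpa using ht)) (Or.inl (by simp)), mul_comm]
      calc ENNReal.ofReal t * μ {x | h x = ∞}
          ≤ ENNReal.ofReal t * μ {x | ENNReal.ofReal t < h x} := by
            gcongr with x
            intro hx
            rw [hx]; simp
        _ ≤ 2 * N * ν {x | ENNReal.ofReal (t / 2) < f x} := hweak t ht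
        _ ≤ _ := by gcongr; exact subset_univ _
    have hz : μ {x | h x = ∞} = 0 := by
      have hlim : Filter.Tendsto (fun t : ℝ => 2 * N * ν univ / ENNReal.ofReal t) Filter.atTop
          (nhds (2 * N * ν univ / ∞)) := by
        refine ENNReal.Tendsto.const_div ENNReal.tendsto_ofReal_atTop (Or.inr ?_)
        finiteness
      rw [ENNReal.div_top] at hlim
      refine le_antisymm (ge_of_tendsto hlim ?_) zero_le
      filter_upwards [Filter.eventually_gt_atTop 0] with t ht using hle t ht
    rw [ae_iff]
    simpa using hz
  have hνμ : ν ≪ μ := withDensity_absolutelyContinuous _ _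
  calc ∫⁻ x, h x ^ r ∂μ = ∫⁻ x, ENNReal.ofReal ((h x).toReal ^ r) ∂μ := by
        refine lintegral_congr_ae ?_
        filter_upwards [hht] with x hx
        rw [← ENNReal.ofReal_rpow_of_nonneg ENNReal.toReal_nonneg hr0.le,
          ENNReal.ofReal_toReal hx.ne]
    _ = ENNReal.ofReal r * ∫⁻ t in Ioi 0, μ {x | t < (h x).toReal} * ENNReal.ofReal (t ^ (r - 1)) :=
        lintegral_rpow_eq_lintegral_meas_lt_mul μ
          (Filter.Eventually.of_forall fun x => ENNReal.toReal_nonneg)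
          hhm.ennreal_toReal.aemeasurable hr0
    _ ≤ ENNReal.ofReal r * ∫⁻ t in Ioi 0, 2 * N *
          (ν {x | t < 2 * (f x).toReal} * ENNReal.ofReal (t ^ (r - 1 - 1))) := by
        gcongr ENNReal.ofReal r * ?_
        refine setLIntegral_mono' measurableSet_Ioi fun t ht => ?_
        have ht0 : 0 < t := ht
        have h1 : μ {x | t < (h x).toReal} ≤ μ {x | ENNReal.ofReal t < h x} :=
          measure_mono fun x hx => (ENNReal.ofReal_lt_iff_lt_toReal ht0.le (by
            rintro hc
            simp [hc] at hx
            linarith)).2 hx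
        have h2 : ν {x | ENNReal.ofReal (t / 2) < f x} ≤ ν {x | t < 2 * (f x).toReal} := by
          refine measure_mono_ae ?_
          filter_upwards [hνμ.ae_le hft] with x hx hx'
          have := (ENNReal.ofReal_lt_iff_lt_toReal (by positivity) hx.ne).1 hx'
          change t < 2 * (f x).toReal
          linarith
        -- One factor t is spent on the weak estimate; the rest is the layer cake weight for
        -- exponent r - 1 with respect to ν = f dμ.
        have e : ENNReal.ofReal (t ^ (r - 1)) =
            ENNReal.ofReal t * ENNReal.ofReal (t ^ (r - 1 - 1)) := by
          rw [← ENNReal.ofReal_mul ht0.le, Real.rpow_sub_one ht0.ne' (r - 1)]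
          congr 1
          field_simp
        calc μ {x | t < (h x).toReal} * ENNReal.ofReal (t ^ (r - 1))
            ≤ μ {x | ENNReal.ofReal t < h x} * ENNReal.ofReal (t ^ (r - 1)) := by gcongr
          _ = ENNReal.ofReal t * μ {x | ENNReal.ofReal t < h x} *
              ENNReal.ofReal (t ^ (r - 1 - 1)) := by rw [e]; ring
          _ ≤ 2 * N * ν {x | ENNReal.ofReal (t / 2) < f x} * ENNReal.ofReal (t ^ (r - 1 - 1)) :=
              mul_le_mul_left (hweak t ht0) _
          _ ≤ 2 * N * ν {x | t < 2 * (f x).toReal} * ENNReal.ofReal (t ^ (r - 1 - 1)) := by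
              gcongr
          _ = _ := mul_assoc _ _ _
    _ = ENNReal.ofReal r * (2 * N) * ∫⁻ t in Ioi 0,
          ν {x | t < 2 * (f x).toReal} * ENNReal.ofReal (t ^ (r - 1 - 1)) := by
        rw [lintegral_const_mul' _ _ (by finiteness)]; ring
    _ = ENNReal.ofReal r * (2 * N) * ((ENNReal.ofReal (r - 1))⁻¹ *
          ∫⁻ x, ENNReal.ofReal ((2 * (f x).toReal) ^ (r - 1)) ∂ν) := by
        congr 1
        rw [lintegral_rpow_eq_lintegral_meas_lt_mul ν
          (Filter.Eventually.of_forall fun x => by positivity)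
          (hf.ennreal_toReal.const_mul 2).aemeasurable hr1, ← mul_assoc,
          ENNReal.inv_mul_cancel (by simpa using hr) (by simp), one_mul]
    _ = ENNReal.ofReal r * (2 * N) * ((ENNReal.ofReal (r - 1))⁻¹ * 2 ^ (r - 1)) *
          ∫⁻ x, f x ^ r ∂μ := by
        have : ∫⁻ x, ENNReal.ofReal ((2 * (f x).toReal) ^ (r - 1)) ∂ν =
            2 ^ (r - 1) * ∫⁻ x, f x ^ r ∂μ := by
          rw [← lintegral_const_mul' _ _ h2r, hν, lintegral_withDensity_eq_lintegral_mul _ hf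
            (by fun_prop)]
          refine lintegral_congr_ae ?_
          filter_upwards [hft] with x hx
          rw [Pi.mul_apply, ← ENNReal.ofReal_rpow_of_nonneg (by positivity) hr1.le,
            ENNReal.ofReal_mul zero_le_two, ENNReal.ofReal_toReal hx.ne,
            ENNReal.mul_rpow_of_nonneg _ _ hr1.le, ENNReal.ofReal_ofNat]
          conv_rhs => rw [show r = (r - 1) + 1 by ring,
            ENNReal.rpow_add_of_nonneg _ _ hr1.le zero_le_one, ENNReal.rpow_one]
          simp only [add_sub_cancel_right]
          ring
        rw [this]
        ring

/-- The finite energy condition yields a solution with finite energy. -/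
theorem exists_supersolution_finite_energy (hp : 1 < p) (hq : 0 < q) (hqp : q < p - 1)
    {μ : Measure (EuclideanSpace ℝ (Fin n))} [IsFiniteMeasure μ]
    (hμ : ∫⁻ x, wolffPotential α p μ x ^ ((1 + q) * (p - 1) / (p - 1 - q)) ∂μ < ∞) :
    ∃ u, IsSupersolution α p q μ u ∧ ∫⁻ x, u x ^ (1 + q) ∂μ < ∞ := by
  have hp1 : 0 < p - 1 := by linarith
  have hpq : 0 < p - 1 - q := by linarith
  have hq1 : 0 < 1 + q := by linarith
  set δ := q / (p - 1) with hδ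
  have hδ0 : 0 < δ := by positivity
  have hδ1 : δ < 1 := (div_lt_one hp1).2 hqp
  obtain ⟨C, hC, hit⟩ := exists_iteration n α hp hq hqp
  have hr : 1 < (1 + q) / q := by rw [lt_div_iff₀ hq]; linarith
  obtain ⟨K, hK, hKf⟩ := exists_lintegral_wolffPotential_div_rpow_le n α hp hr
  obtain ⟨f, hfm, hmono, hsucc, hC0, -, hpos⟩ := hit μ
  refine ⟨_, isSupersolution_iSup hp hq hfm hmono hsucc hpos, ?_⟩
  rw [lintegral_iSup_rpow hq1 hfm hmono]
  set J := ∫⁻ x, wolffPotential α p μ x ^ ((1 + q) * (p - 1) / (p - 1 - q)) ∂μ with hJ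
  set A := K ^ δ * J ^ (1 - δ) with hA
  have hAt : A ≠ ∞ := ENNReal.mul_ne_top (ENNReal.rpow_lt_top_of_nonneg hδ0.le hK).ne
    (ENNReal.rpow_lt_top_of_nonneg (by linarith) hμ.ne).ne
  refine lt_of_le_of_lt (b := A ^ (1 - δ)⁻¹) (iSup_le fun k => ?_)
    (ENNReal.rpow_lt_top_of_nonneg (inv_nonneg.2 (by linarith)) hAt)
  refine le_rpow_of_sublinear_recursion (I := fun k => ∫⁻ y, f k y ^ (1 + q) ∂μ) hδ0 hδ1
    hAt ?_ ?_ (fun k hk => ?_) k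
  · refine ne_top_of_le_ne_top ?_ (lintegral_mono fun y => ENNReal.rpow_le_rpow (hC0 y) hq1.le)
    rw [lintegral_const]
    exact ENNReal.mul_ne_top (ENNReal.rpow_lt_top_of_nonneg hq1.le hC).ne (measure_ne_top _ _)
  · exact lintegral_mono fun y => ENNReal.rpow_le_rpow (hmono zero_le_one y) hq1.le
  · rcases eq_or_ne μ 0 with rfl | hμ0
    · simp
    have e1 : ∀ x, (f k x ^ q) ^ ((1 + q) / q) = f k x ^ (1 + q) := fun x => by
      rw [← ENNReal.rpow_mul]; congr 1; field_simp
    have hle := hKf μ (fun y => f k y ^ q) ((hfm k).pow_const q) (by simpa only [e1] using hk)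
    simp only [e1, ← hsucc] at hle
    have hWt : ∀ᵐ x ∂μ, wolffPotential α p μ x < ∞ := by
      filter_upwards [ae_lt_top (measurable_wolffPotential.pow_const _) hμ.ne] with x hx
      by_contra! hc
      rw [top_le_iff.1 hc, ENNReal.top_rpow_of_pos (by positivity)] at hx
      exact hx.ne rfl
    set h : EuclideanSpace ℝ (Fin n) → ℝ≥0∞ :=
      fun x => ((f (k + 1) x / wolffPotential α p μ x) ^ (p - 1)) ^ ((1 + q) / q) with hh
    have hhm : Measurable h :=
      (((hfm (k + 1)).div measurable_wolffPotential).pow_const _).pow_const _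
    -- Write f_{k+1} = (f_{k+1}/W)·W and apply Hölder with weights δ and 1 - δ; the first factor
    -- falls under the strong type estimate with r = (1+q)/q.
    calc ∫⁻ y, f (k + 1) y ^ (1 + q) ∂μ = ∫⁻ y, h y ^ δ *
          (wolffPotential α p μ y ^ ((1 + q) * (p - 1) / (p - 1 - q))) ^ (1 - δ) ∂μ := by
          refine lintegral_congr_ae ?_
          filter_upwards [hWt] with x hx
          rw [hh]
          dsimp only
          rw [← ENNReal.rpow_mul, ← ENNReal.rpow_mul, ← ENNReal.rpow_mul,
            show (p - 1) * ((1 + q) / q * δ) = 1 + q by rw [hδ]; field_simp,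
            show (1 + q) * (p - 1) / (p - 1 - q) * (1 - δ) = 1 + q by rw [hδ]; field_simp,
            ← ENNReal.mul_rpow_of_nonneg _ _ hq1.le,
            ENNReal.div_mul_cancel (wolffPotential_pos hp hμ0 x).ne' hx.ne]
      _ ≤ (∫⁻ y, h y ∂μ) ^ δ * J ^ (1 - δ) :=
          ENNReal.lintegral_mul_norm_pow_le hhm.aemeasurable
            (measurable_wolffPotential.pow_const _).aemeasurable hδ0.le (by linarith) (by ring)
      _ ≤ (K * ∫⁻ y, f k y ^ (1 + q) ∂μ) ^ δ * J ^ (1 - δ) := by gcongr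
      _ = A * (∫⁻ y, f k y ^ (1 + q) ∂μ) ^ δ := by
          rw [ENNReal.mul_rpow_of_nonneg _ _ hδ0.le, hA]; ring

end Energy

/-! ### The function of the bilateral estimate as an approximate supersolution. -/

section Bilateral

variable {n : ℕ} {α p q : ℝ} {σ : Measure (EuclideanSpace ℝ (Fin n))}

theorem le_inv_mul_of_mul_le {a b c : ℝ≥0∞} (hc0 : c ≠ 0) (hct : c ≠ ∞) (h : c * a ≤ b) :
    a ≤ c⁻¹ * b := by
  rwa [← ENNReal.div_eq_inv_mul, ENNReal.le_div_iff_mul_le (Or.inl hc0) (Or.inl hct), mul_comm]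

/-- On each ball κ^s is bounded by the mass of u^q dσ; integrating over radii turns this into the
Wolff potential of u^q dσ, hence into u. -/
theorem exists_intrinsicPotential_le (n : ℕ) (α : ℝ) (hp : 1 < p) (hq : 0 < q)
    (hqp : q < p - 1) :
    ∃ C : ℝ≥0∞, C ≠ ∞ ∧ ∀ (σ : Measure (EuclideanSpace ℝ (Fin n)))
      (u : EuclideanSpace ℝ (Fin n) → ℝ≥0∞), IsSupersolution α p q σ u →
      ∀ x, intrinsicPotential α p q σ x ≤ C * u x := by
  have hp1 : 0 < p - 1 := by linarith
  obtain ⟨C, -, hCt, hC⟩ := exists_kappa_rpow_le n α hp hq hqp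
  refine ⟨C ^ (1 / (p - 1)), (ENNReal.rpow_lt_top_of_nonneg (by positivity) hCt).ne,
    fun σ u hu x => ?_⟩
  calc intrinsicPotential α p q σ x
      ≤ tailIntegral n α p (fun r => C * ∫⁻ y in ball x r, u y ^ q ∂σ) 0 :=
        tailIntegral_mono hp fun r _ => hC σ _ u (hu.restrict hp _)
    _ = C ^ (1 / (p - 1)) * wolffPotential α p (σ.withDensity fun y => u y ^ q) x := by
        rw [tailIntegral_const_mul hp (measurable_setLIntegral_ball _), wolffPotential_withDensity]
    _ ≤ _ := by gcongr; exact hu.le x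

/-- The contribution of the scales larger than `r` to the function that appears in the bilateral
estimate. -/
def tailPotential (α p q : ℝ) (σ : Measure (EuclideanSpace ℝ (Fin n)))
    (x : EuclideanSpace ℝ (Fin n)) (r : ℝ) : ℝ≥0∞ :=
  tailIntegral n α p (fun s => kappa α p q σ (ball x s) ^ (q * (p - 1) / (p - 1 - q))) r +
    tailIntegral n α p (fun s => σ (ball x s)) r ^ ((p - 1) / (p - 1 - q))

theorem tailPotential_anti (hqp : q < p - 1) (hq : 0 < q) (x : EuclideanSpace ℝ (Fin n))
    {r r' : ℝ} (h : r ≤ r') : tailPotential α p q σ x r' ≤ tailPotential α p q σ x r := by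
  have hb : 0 ≤ (p - 1) / (p - 1 - q) := by
    have : 0 < p - 1 := by linarith
    have : 0 < p - 1 - q := by linarith
    positivity
  exact add_le_add (tailIntegral_anti h) (ENNReal.rpow_le_rpow (tailIntegral_anti h) hb)

/-- On a ball, the function of the bilateral estimate is controlled by any supersolution for the
restriction of `σ` to the doubled ball, and by the tail. -/
theorem exists_tailPotential_zero_le (n : ℕ) (α : ℝ) (hp : 1 < p) (hq : 0 < q)
    (hqp : q < p - 1) :
    ∃ C : ℝ≥0∞, C ≠ 0 ∧ C ≠ ∞ ∧ ∀ (σ : Measure (EuclideanSpace ℝ (Fin n))) [SFinite σ]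
      (x : EuclideanSpace ℝ (Fin n)) (r : ℝ), 0 < r →
      ∀ u, IsSupersolution α p q (σ.restrict (ball x (2 * r))) u → ∀ y ∈ ball x r,
        tailPotential α p q σ y 0 ≤ C * (u y + tailPotential α p q σ x r) := by
  have hp1 : 0 < p - 1 := by linarith
  have hpq : 0 < p - 1 - q := by linarith
  set b := (p - 1) / (p - 1 - q) with hb
  have hb0 : 0 < b := by positivity
  set s := q * (p - 1) / (p - 1 - q) with hs
  have hs0 : 0 < s := by positivity
  have hγ : 0 ≤ 1 / (p - 1) := by positivity
  obtain ⟨C₁, -, hC₁t, hC₁⟩ := exists_kappa_rpow_le n α hp hq hqp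
  obtain ⟨c, hc0, hct, hc⟩ := exists_le_supersolution n α hp hq hqp
  set D := doublingConst n α p with hD
  have hDt : D ≠ ∞ := doublingConst_ne_top hp
  have h2b : (2 : ℝ≥0∞) ^ b ≠ ∞ := (ENNReal.rpow_lt_top_of_nonneg hb0.le (by simp)).ne
  have hDb : D ^ b ≠ ∞ := (ENNReal.rpow_lt_top_of_nonneg hb0.le hDt).ne
  have hCγ : C₁ ^ (1 / (p - 1)) ≠ ∞ := (ENNReal.rpow_lt_top_of_nonneg hγ hC₁t).ne
  have hci : c⁻¹ ≠ ∞ := ENNReal.inv_ne_top.2 hc0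
  refine ⟨(C₁ ^ (1 / (p - 1)) + 2 ^ b * c⁻¹) + (D + 2 ^ b * D ^ b), ?_, by finiteness,
    fun σ _ x r hr u hu y hy => ?_⟩
  · have : 0 < D := doublingConst_pos
    exact ne_of_gt (by positivity)
  set B := ball x (2 * r) with hB
  set Kt := tailIntegral n α p (fun t => kappa α p q σ (ball x t) ^ s) r with hKt
  set Wt := tailIntegral n α p (fun t => σ (ball x t)) r with hWt
  have hyB : ∀ t, t ≤ r → ball y t ⊆ B := fun t ht => ball_subset_ball' (by
    have := mem_ball.1 hy; linarith)
  have hrestr : ∀ t, t ≤ r → (σ.restrict B).restrict (ball y t) = σ.restrict (ball y t) :=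
    fun t ht => by
      rw [Measure.restrict_restrict measurableSet_ball, inter_eq_self_of_subset_left (hyB t ht)]
  -- At scales t ≤ r the ball B(y,t) stays inside `B`, where u controls κ; larger scales are
  -- recentred at x.
  have hK : tailIntegral n α p (fun t => kappa α p q σ (ball y t) ^ s) 0 ≤
      C₁ ^ (1 / (p - 1)) * u y + D * Kt := by
    refine (tailIntegral_le_of_forall_le hp hr.le
      (ψ := fun t => C₁ * ∫⁻ z in ball y t, u z ^ q ∂(σ.restrict B)) fun t _ ht => ?_).trans
      (add_le_add ?_ (tailIntegral_ball_le hp (kappa_rpow_mono hq hs0.le) hr.le (mem_ball'.1 hy).le))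
    · rw [hrestr t ht]
      exact hC₁ σ _ u (hrestr t ht ▸ hu.restrict hp _)
    · rw [tailIntegral_const_mul hp (measurable_setLIntegral_ball _), ← wolffPotential_withDensity]
      gcongr
      exact hu.le y
  have hW : wolffPotential α p σ y ^ b ≤ 2 ^ b * (c⁻¹ * u y + D ^ b * Wt ^ b) := by
    calc wolffPotential α p σ y ^ b
        ≤ (wolffPotential α p (σ.restrict B) y + D * Wt) ^ b := by
          gcongr; exact wolffPotential_le_restrict_add hp hr.le hy
      _ ≤ 2 ^ b * (wolffPotential α p (σ.restrict B) y ^ b + (D * Wt) ^ b) := add_rpow_le hb0.le _ _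
      _ ≤ _ := by
          rw [ENNReal.mul_rpow_of_nonneg _ _ hb0.le]
          gcongr
          exact le_inv_mul_of_mul_le hc0 hct (hc _ u hu y)
  calc tailPotential α p q σ y 0
      ≤ (C₁ ^ (1 / (p - 1)) * u y + D * Kt) + 2 ^ b * (c⁻¹ * u y + D ^ b * Wt ^ b) :=
        add_le_add hK hW
    _ = (C₁ ^ (1 / (p - 1)) + 2 ^ b * c⁻¹) * u y + (D * Kt + 2 ^ b * D ^ b * Wt ^ b) := by ring
    _ ≤ (C₁ ^ (1 / (p - 1)) + 2 ^ b * c⁻¹) * u y +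
        (D + 2 ^ b * D ^ b) * (Kt + Wt ^ b) := by
        rw [add_mul D]
        gcongr
        · exact le_self_add
        · exact le_add_self
    _ ≤ (C₁ ^ (1 / (p - 1)) + 2 ^ b * c⁻¹ + (D + 2 ^ b * D ^ b)) * u y +
        (C₁ ^ (1 / (p - 1)) + 2 ^ b * c⁻¹ + (D + 2 ^ b * D ^ b)) * (Kt + Wt ^ b) :=
        add_le_add (mul_le_mul' le_self_add le_rfl) (mul_le_mul' le_add_self le_rfl)
    _ = _ := (mul_add _ _ _).symm

/-- The function of the bilateral estimate is a supersolution up to a constant. -/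
theorem exists_wolffPotential_le_tailPotential (n : ℕ) (α : ℝ) (hp : 1 < p) (hq : 0 < q)
    (hqp : q < p - 1) :
    ∃ C : ℝ≥0∞, C ≠ ∞ ∧ ∀ (σ : Measure (EuclideanSpace ℝ (Fin n))) [IsLocallyFiniteMeasure σ]
      (L : ℝ≥0∞) (f : EuclideanSpace ℝ (Fin n) → ℝ≥0∞), L ≠ 0 →
      (∀ x, f x ≤ L * tailPotential α p q σ x 0) →
      ∀ x, wolffPotential α p (σ.withDensity fun y => f y ^ q) x ≤
        C * L ^ (q / (p - 1)) * tailPotential α p q σ x 0 := by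
  have hp1 : 0 < p - 1 := by linarith
  have hpq : 0 < p - 1 - q := by linarith
  set b := (p - 1) / (p - 1 - q) with hb
  have hb0 : 0 < b := by positivity
  set s := q * (p - 1) / (p - 1 - q) with hs
  have hs0 : 0 < s := by positivity
  have hγ : 0 ≤ 1 / (p - 1) := by positivity
  set δ := q / (p - 1) with hδ
  have hδ0 : 0 < δ := by positivity
  have hδ1 : δ < 1 := (div_lt_one hp1).2 hqp
  have hbi : b⁻¹ = 1 - δ := by rw [hδ, hb]; field_simp
  obtain ⟨C₁, hC₁0, hC₁t, hC₁⟩ := exists_tailPotential_zero_le n α hp hq hqp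
  set D := doublingConst n α p with hD
  have hDt : D ≠ ∞ := doublingConst_ne_top hp
  set C₂ := C₁ ^ q * 2 ^ q with hC₂
  have h2q : (2 : ℝ≥0∞) ^ q ≠ ∞ := (ENNReal.rpow_lt_top_of_nonneg hq.le (by simp)).ne
  have hC₂t : C₂ ≠ ∞ := ENNReal.mul_ne_top (ENNReal.rpow_lt_top_of_nonneg hq.le hC₁t).ne h2q
  have hC₂γ : C₂ ^ (1 / (p - 1)) ≠ ∞ := (ENNReal.rpow_lt_top_of_nonneg hγ hC₂t).ne
  have h2γ : (2 : ℝ≥0∞) ^ (1 / (p - 1)) ≠ ∞ := (ENNReal.rpow_lt_top_of_nonneg hγ (by simp)).ne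
  refine ⟨C₂ ^ (1 / (p - 1)) * 2 ^ (1 / (p - 1)) * (D + 1), by finiteness,
    fun σ _ L f hL hf x => ?_⟩
  set V := tailPotential α p q σ x 0 with hV
  -- The local supersolution depends on r, but only its mass, at most κ(B(x,2r))^s, survives. When κ
  -- is infinite the bound is trivial, provided its constant factor is nonzero.
  have hballs : ∀ r, 0 < r → ∫⁻ y in ball x r, f y ^ q ∂σ ≤
      C₂ * L ^ q * (kappa α p q σ (ball x (2 * r)) ^ s + V ^ q * σ (ball x r)) := by
    intro r hr
    by_cases hκ : kappa α p q σ (ball x (2 * r)) = ∞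
    · have h0 : C₂ * L ^ q ≠ 0 := by
        simp only [hC₂, Ne, mul_eq_zero, ENNReal.rpow_eq_zero_iff_of_pos hq]
        simp [hC₁0, hL]
      rw [hκ, ENNReal.top_rpow_of_pos hs0, top_add, ENNReal.mul_top h0]
      exact le_top
    obtain ⟨u, hu, huκ⟩ := exists_supersolution_lintegral_le_kappa hp hq hqp
      (measure_ball_lt_top (x := x) (r := 2 * r)).ne hκ
    calc ∫⁻ y in ball x r, f y ^ q ∂σ
        ≤ ∫⁻ y in ball x r, C₂ * L ^ q * (u y ^ q + V ^ q) ∂σ := by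
          refine setLIntegral_mono' measurableSet_ball fun y hy => ?_
          calc f y ^ q ≤ (L * (C₁ * (u y + V))) ^ q := by
                gcongr
                refine (hf y).trans ?_
                gcongr
                refine (hC₁ σ x r hr u hu y hy).trans ?_
                gcongr
                exact tailPotential_anti hqp hq x hr.le
            _ = L ^ q * C₁ ^ q * (u y + V) ^ q := by
                rw [ENNReal.mul_rpow_of_nonneg _ _ hq.le, ENNReal.mul_rpow_of_nonneg _ _ hq.le,
                  mul_assoc]
            _ ≤ L ^ q * C₁ ^ q * (2 ^ q * (u y ^ q + V ^ q)) := by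
                gcongr; exact add_rpow_le hq.le _ _
            _ = _ := by rw [hC₂]; ring
      _ = C₂ * L ^ q * (∫⁻ y in ball x r, u y ^ q ∂σ + V ^ q * σ (ball x r)) := by
          rw [lintegral_const_mul _ ((hu.measurable.pow_const q).add_const _),
            lintegral_add_right _ measurable_const, setLIntegral_const]
      _ ≤ _ := by
          gcongr
          exact (lintegral_mono_set (ball_subset_ball (by linarith))).trans huκ
  have hmK : Measurable fun r => kappa α p q σ (ball x (2 * r)) ^ s :=
    (measurable_comp_ball (kappa_rpow_mono hq hs0.le) x).comp (measurable_const_mul 2)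
  have hmW := measurable_measure_ball σ x
  -- This closes the estimate: V^δ W σ(x) ≤ V^δ V^(1-δ) = V.
  have hWV : wolffPotential α p σ x ≤ V ^ (1 - δ) := by
    rw [← hbi, ENNReal.le_rpow_inv_iff hb0]
    exact le_add_self
  calc wolffPotential α p (σ.withDensity fun y => f y ^ q) x
      ≤ tailIntegral n α p (fun r => C₂ * L ^ q *
          (kappa α p q σ (ball x (2 * r)) ^ s + V ^ q * σ (ball x r))) 0 := by
        rw [wolffPotential_withDensity]
        exact tailIntegral_mono hp hballs
    _ = (C₂ * L ^ q) ^ (1 / (p - 1)) * tailIntegral n α p (fun r =>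
          kappa α p q σ (ball x (2 * r)) ^ s + V ^ q * σ (ball x r)) 0 :=
        tailIntegral_const_mul hp (hmK.add (hmW.const_mul _)) _
    _ ≤ (C₂ * L ^ q) ^ (1 / (p - 1)) * (2 ^ (1 / (p - 1)) *
          (tailIntegral n α p (fun r => kappa α p q σ (ball x (2 * r)) ^ s) 0 +
            tailIntegral n α p (fun r => V ^ q * σ (ball x r)) 0)) := by
        gcongr; exact tailIntegral_add_le hp hmK
    _ ≤ (C₂ * L ^ q) ^ (1 / (p - 1)) * (2 ^ (1 / (p - 1)) * (D * V + 1 * V)) := by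
        gcongr
        · rw [tailIntegral_comp_mul hp (φ := fun r => kappa α p q σ (ball x r) ^ s) two_pos le_rfl,
            mul_zero]
          exact mul_le_mul_right le_self_add _
        · rw [tailIntegral_const_mul hp hmW, ← ENNReal.rpow_mul, mul_one_div, ← hδ, one_mul]
          calc V ^ δ * wolffPotential α p σ x ≤ V ^ δ * V ^ (1 - δ) := by gcongr
            _ = V := by
              rw [← ENNReal.rpow_add_of_nonneg _ _ hδ0.le (by linarith), add_sub_cancel,
                ENNReal.rpow_one]
    _ = _ := by
        rw [ENNReal.mul_rpow_of_nonneg _ _ hγ, ← ENNReal.rpow_mul L, mul_one_div, ← hδ]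
        ring

end Bilateral

/-! ### Existence, local integrability and necessity. -/

section Main

variable {n : ℕ} {α p q : ℝ} {σ : Measure (EuclideanSpace ℝ (Fin n))}

/-- Local integrability of functions dominated by the function of the bilateral estimate. -/
theorem lintegral_rpow_lt_top_of_le_tailPotential (hp : 1 < p) (hq : 0 < q) (hqp : q < p - 1)
    [IsLocallyFiniteMeasure σ] (ha : WolffFiniteAtInfinity α p σ)
    (hb : IntrinsicFiniteAtInfinity α p q σ) (hc : LocalWolffCondition α p q σ)
    {L : ℝ≥0∞} (hL : L ≠ ∞) {u : EuclideanSpace ℝ (Fin n) → ℝ≥0∞}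
    (hu : ∀ x, u x ≤ L * tailPotential α p q σ x 0) {K : Set (EuclideanSpace ℝ (Fin n))}
    (hK : IsCompact K) : ∫⁻ x in K, u x ^ (1 + q) ∂σ < ∞ := by
  have hp1 : 0 < p - 1 := by linarith
  have hpq : 0 < p - 1 - q := by linarith
  have hq1 : 0 < 1 + q := by linarith
  obtain ⟨C, -, hCt, hC⟩ := exists_tailPotential_zero_le n α hp hq hqp
  obtain ⟨R₀, hR₀⟩ := hK.isBounded.subset_ball 0
  -- R ≥ 1 lets (a) and (b), which start at radius 1, bound the tail from R on.
  set R := max R₀ 1 with hR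
  have hR1 : 1 ≤ R := le_max_right _ _
  have hR0 : 0 < R := by linarith
  have hKR : K ⊆ ball 0 R := hR₀.trans (ball_subset_ball (le_max_left _ _))
  have : IsFiniteMeasure (σ.restrict (ball 0 (2 * R))) :=
    ⟨by rw [Measure.restrict_apply_univ]; exact measure_ball_lt_top⟩
  obtain ⟨w, hw, hwt⟩ := exists_supersolution_finite_energy hp hq hqp (hc 0 (2 * R) (by linarith))
  set V := tailPotential α p q σ 0 R with hV
  have hVt : V ≠ ∞ := by
    refine ne_top_of_le_ne_top ?_ (tailPotential_anti hqp hq 0 hR1)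
    exact ENNReal.add_ne_top.2 ⟨hb.ne, (ENNReal.rpow_lt_top_of_nonneg (by positivity) ha.ne).ne⟩
  have hVq : V ^ (1 + q) ≠ ∞ := (ENNReal.rpow_lt_top_of_nonneg hq1.le hVt).ne
  set A := (L * C) ^ (1 + q) * 2 ^ (1 + q) with hA
  have hAt : A ≠ ∞ := ENNReal.mul_ne_top
    (ENNReal.rpow_lt_top_of_nonneg hq1.le (ENNReal.mul_ne_top hL hCt)).ne
    (ENNReal.rpow_lt_top_of_nonneg hq1.le (by simp)).ne
  calc ∫⁻ x in K, u x ^ (1 + q) ∂σ ≤ ∫⁻ x in ball 0 R, u x ^ (1 + q) ∂σ := lintegral_mono_set hKR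
    _ ≤ ∫⁻ x in ball 0 R, A * (w x ^ (1 + q) + V ^ (1 + q)) ∂σ := by
        refine setLIntegral_mono' measurableSet_ball fun y hy => ?_
        calc u y ^ (1 + q) ≤ (L * C * (w y + V)) ^ (1 + q) := by
              gcongr
              rw [mul_assoc]
              refine (hu y).trans ?_
              gcongr
              exact hC σ 0 R hR0 w hw y hy
          _ = (L * C) ^ (1 + q) * (w y + V) ^ (1 + q) := ENNReal.mul_rpow_of_nonneg _ _ hq1.le
          _ ≤ (L * C) ^ (1 + q) * (2 ^ (1 + q) * (w y ^ (1 + q) + V ^ (1 + q))) := by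
              gcongr; exact add_rpow_le hq1.le _ _
          _ = _ := by rw [hA, mul_assoc]
    _ = A * (∫⁻ x in ball 0 R, w x ^ (1 + q) ∂σ + V ^ (1 + q) * σ (ball 0 R)) := by
        rw [lintegral_const_mul' _ _ hAt, lintegral_add_right _ measurable_const, setLIntegral_const]
    _ < ∞ := by
        refine ENNReal.mul_lt_top hAt.lt_top (ENNReal.add_lt_top.2 ⟨?_, ?_⟩)
        · exact (lintegral_mono_set (ball_subset_ball (by linarith))).trans_lt hwt
        · exact ENNReal.mul_lt_top hVq.lt_top measure_ball_lt_top

/-- There is a solution that is dominated by the function of the bilateral estimate. -/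
theorem exists_isSolution_le_tailPotential (n : ℕ) (α : ℝ) (hp : 1 < p) (hq : 0 < q)
    (hqp : q < p - 1) :
    ∃ L : ℝ≥0∞, L ≠ ∞ ∧ ∀ (σ : Measure (EuclideanSpace ℝ (Fin n))) [IsLocallyFiniteMeasure σ],
      σ ≠ 0 → ∃ u : EuclideanSpace ℝ (Fin n) → ℝ≥0∞, IsSolution α p q σ u ∧
        ∀ x, u x ≤ L * tailPotential α p q σ x 0 := by
  have hp1 : 0 < p - 1 := by linarith
  set δ := q / (p - 1) with hδ
  have hδ0 : 0 < δ := by positivity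
  have hδ1 : δ < 1 := (div_lt_one hp1).2 hqp
  have hδ' : 0 < 1 - δ := by linarith
  obtain ⟨C₀, hC₀t, hit⟩ := exists_iteration n α hp hq hqp
  obtain ⟨C₁, hC₁t, hC₁⟩ := exists_wolffPotential_le_tailPotential n α hp hq hqp
  set M := max (max C₀ C₁) 1 with hM
  have hMt : M ≠ ∞ := by simp [hM, hC₀t, hC₁t]
  have hM1 : 1 ≤ M := le_max_right _ _
  have hM0 : M ≠ 0 := (one_pos.trans_le hM1).ne'
  -- The fixed point of t ↦ M t^δ, so domination by L·V is preserved by the iteration; M ≥ 1 gives M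
  -- ≤ L, which covers the starting function.
  set L := M ^ (1 - δ)⁻¹ with hL
  have hLt : L ≠ ∞ := (ENNReal.rpow_lt_top_of_nonneg (by positivity) hMt).ne
  have hML : M ≤ L := by
    conv_lhs => rw [← ENNReal.rpow_one M]
    exact ENNReal.rpow_le_rpow_of_exponent_le hM1 ((one_le_inv₀ hδ').2 (by linarith))
  have hL0 : L ≠ 0 := (hM0.bot_lt.trans_le hML).ne'
  have hfix : M * L ^ δ = L := by
    rw [hL, ← ENNReal.rpow_mul]
    conv_lhs => rw [← ENNReal.rpow_one M, ← ENNReal.rpow_mul, ← ENNReal.rpow_add _ _ hM0 hMt]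
    congr 1
    field_simp
    ring
  refine ⟨L, hLt, fun σ _ hσ => ?_⟩
  obtain ⟨f, hfm, hmono, hsucc, -, hf0, hpos⟩ := hit σ
  have hfL : ∀ k x, f k x ≤ L * tailPotential α p q σ x 0 := by
    intro k
    induction k with
    | zero =>
      intro x
      refine (hf0 x).trans (mul_le_mul' ?_ le_add_self)
      exact ((le_max_left _ _).trans (le_max_left _ _)).trans hML
    | succ k ih =>
      intro x
      rw [hsucc]
      refine (hC₁ σ L (f k) hL0 ih x).trans ?_
      gcongr
      refine le_trans ?_ hfix.le
      gcongr
      exact (le_max_right _ _).trans (le_max_left _ _)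
  exact ⟨fun x => ⨆ k, f k x,
    { measurable := Measurable.iSup hfm
      pos := fun x => (hpos hσ x).trans_le (le_iSup (fun k => f k x) 0)
      eq := fun x => iSup_iteration_eq hp hq hfm hmono hsucc x }, fun x => iSup_le fun k => hfL k x⟩

theorem IsSolution.isSupersolution {u : EuclideanSpace ℝ (Fin n) → ℝ≥0∞}
    (hu : IsSolution α p q σ u) : IsSupersolution α p q σ u where
  measurable := hu.measurable
  pos := Filter.Eventually.of_forall hu.pos
  le := fun x => (hu.eq x).ge

/-- A solution almost everywhere agrees almost everywhere with a solution everywhere. -/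
theorem IsSolutionAE.exists_isSolution (hp : 1 < p) (hq : 0 < q) [SFinite σ]
    {u : EuclideanSpace ℝ (Fin n) → ℝ≥0∞} (hu : IsSolutionAE α p q σ u) :
    ∃ v, IsSolution α p q σ v ∧ u =ᵐ[σ] v := by
  refine ⟨wolffPotential α p (σ.withDensity fun y => u y ^ q), ⟨measurable_wolffPotential,
    wolffPotential_pos hp fun h0 => hu.nontrivial ?_, fun x => ?_⟩, hu.eq⟩
  · filter_upwards [(withDensity_eq_zero_iff (hu.aemeasurable.pow_const q)).1 h0] with x hx
    exact (ENNReal.rpow_eq_zero_iff_of_pos hq).1 hx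
  · congr 1
    refine withDensity_congr_ae ?_
    filter_upwards [hu.eq] with y hy
    rw [← hy]

/-- The conditions are necessary for the existence of a solution. -/
theorem IsSolution.conditions (hp : 1 < p) (hq : 0 < q) (hqp : q < p - 1)
    [IsLocallyFiniteMeasure σ] (hσ : σ ≠ 0) {u : EuclideanSpace ℝ (Fin n) → ℝ≥0∞}
    (hu : IsSolution α p q σ u) (hloc : MemLsLoc (1 + q) σ u) :
    WolffFiniteAtInfinity α p σ ∧ IntrinsicFiniteAtInfinity α p q σ ∧
      LocalWolffCondition α p q σ := by
  have hp1 : 0 < p - 1 := by linarith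
  have hpq : 0 < p - 1 - q := by linarith
  have hq1 : 0 < 1 + q := by linarith
  obtain ⟨c, hc0, hct, hc⟩ := exists_le_supersolution n α hp hq hqp
  obtain ⟨C, hCt, hC⟩ := exists_intrinsicPotential_le n α hp hq hqp
  -- One point of finiteness suffices for (a) and (b). It exists in any closed ball charged by σ, by
  -- local integrability.
  obtain ⟨x, hx⟩ : ∃ x, u x ≠ ∞ := by
    obtain ⟨k, hk⟩ : ∃ k : ℕ, σ (closedBall 0 k) ≠ 0 := by
      by_contra! h
      have : σ univ = 0 := by
        rw [← iUnion_closedBall_nat (0 : EuclideanSpace ℝ (Fin n))]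
        exact measure_iUnion_null h
      exact hσ (Measure.measure_univ_eq_zero.1 this)
    have h1 := ae_lt_top (hu.measurable.pow_const (1 + q))
      (hloc.2 _ (isCompact_closedBall 0 k)).ne
    have : (ae (σ.restrict (closedBall 0 k))).NeBot :=
      ae_neBot.2 fun h => hk (Measure.restrict_eq_zero.1 h)
    obtain ⟨x, hx⟩ := h1.exists
    refine ⟨x, fun h => ?_⟩
    rw [h, ENNReal.top_rpow_of_pos hq1] at hx
    exact hx.ne rfl
  have hsup := hu.isSupersolution
  refine ⟨?_, ?_, fun z R hR => ?_⟩
  · refine tailIntegral_ball_zero_lt_top hp (measure_monotone σ) (x := x) (lt_top_iff_ne_top.2 ?_)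
    intro h
    have h1 := hc σ u hsup x
    rw [wolffPotential, h, ENNReal.top_rpow_of_pos (by positivity), ENNReal.mul_top hc0] at h1
    exact hx (top_le_iff.1 h1)
  · refine tailIntegral_ball_zero_lt_top hp (kappa_rpow_mono hq (by positivity)) (x := x) ?_
    exact (hC σ u hsup x).trans_lt (ENNReal.mul_lt_top hCt.lt_top (Ne.lt_top hx))
  · have hcq0 : c ^ (1 + q) ≠ 0 := (ENNReal.rpow_pos hc0.bot_lt hct).ne'
    have hcqt : c ^ (1 + q) ≠ ∞ := (ENNReal.rpow_lt_top_of_nonneg hq1.le hct).ne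
    calc ∫⁻ y in ball z R, wolffPotential α p (σ.restrict (ball z R)) y ^
          ((1 + q) * (p - 1) / (p - 1 - q)) ∂σ
        ≤ ∫⁻ y in ball z R, (c ^ (1 + q))⁻¹ * u y ^ (1 + q) ∂σ := by
          refine lintegral_mono fun y => ?_
          refine le_inv_mul_of_mul_le hcq0 hcqt ?_
          rw [show (1 + q) * (p - 1) / (p - 1 - q) = (p - 1) / (p - 1 - q) * (1 + q) by ring,
            ENNReal.rpow_mul, ← ENNReal.mul_rpow_of_nonneg _ _ hq1.le]
          exact ENNReal.rpow_le_rpow (hc _ u (hsup.restrict hp _) y) hq1.le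
      _ = (c ^ (1 + q))⁻¹ * ∫⁻ y in ball z R, u y ^ (1 + q) ∂σ :=
          lintegral_const_mul' _ _ (ENNReal.inv_ne_top.2 hcq0)
      _ < ∞ := ENNReal.mul_lt_top (ENNReal.inv_ne_top.2 hcq0).lt_top
          ((lintegral_mono_set ball_subset_closedBall).trans_lt
            (hloc.2 _ (isCompact_closedBall z R)))

theorem MemLsLoc.congr_ae {s : ℝ} {u v : EuclideanSpace ℝ (Fin n) → ℝ≥0∞} (h : MemLsLoc s σ u)
    (huv : u =ᵐ[σ] v) : MemLsLoc s σ v := by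
  refine ⟨h.1.congr huv, fun K hK => ?_⟩
  have : ∫⁻ x in K, v x ^ s ∂σ = ∫⁻ x in K, u x ^ s ∂σ := by
    refine lintegral_congr_ae (ae_restrict_of_ae ?_)
    filter_upwards [huv] with x hx
    rw [hx]
  rw [this]
  exact h.2 K hK

end Main

end WolffEq

end

/-- The solution that is constructed solves the equation everywhere, while the conditions are shown
to be necessary already for a solution in the `σ`-almost everywhere sense. -/
theorem theorem4p10 (n : ℕ) (p q α : ℝ) (hp : 1 < p) (hq : 0 < q) (hqp : q < p - 1)
    (hα : 0 < α) (hαp : α < (n : ℝ) / p) :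
    ∃ C : ℝ≥0, 0 < C ∧
      ∀ σ : Measure (EuclideanSpace ℝ (Fin n)), IsLocallyFiniteMeasure σ → σ ≠ 0 →
        ((WolffEq.WolffFiniteAtInfinity α p σ ∧ WolffEq.IntrinsicFiniteAtInfinity α p q σ ∧
            WolffEq.LocalWolffCondition α p q σ) →
          ∃ u : EuclideanSpace ℝ (Fin n) → ℝ≥0∞,
            WolffEq.IsSolution α p q σ u ∧
            WolffEq.MemLsLoc (1 + q) σ u ∧
            ∀ x,
              (C : ℝ≥0∞)⁻¹ * (WolffEq.intrinsicPotential α p q σ x +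
                WolffEq.wolffPotential α p σ x ^ ((p - 1) / (p - 1 - q))) ≤ u x ∧
              u x ≤ (C : ℝ≥0∞) * (WolffEq.intrinsicPotential α p q σ x +
                WolffEq.wolffPotential α p σ x ^ ((p - 1) / (p - 1 - q)))) ∧
        ((∃ u : EuclideanSpace ℝ (Fin n) → ℝ≥0∞,
            WolffEq.IsSolutionAE α p q σ u ∧ WolffEq.MemLsLoc (1 + q) σ u) →
          WolffEq.WolffFiniteAtInfinity α p σ ∧ WolffEq.IntrinsicFiniteAtInfinity α p q σ ∧
            WolffEq.LocalWolffCondition α p q σ) := by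
  obtain ⟨L, hLt, hL⟩ := WolffEq.exists_isSolution_le_tailPotential n α hp hq hqp
  obtain ⟨c, hc0, hct, hc⟩ := WolffEq.exists_le_supersolution n α hp hq hqp
  obtain ⟨C₁, hC₁t, hC₁⟩ := WolffEq.exists_intrinsicPotential_le n α hp hq hqp
  have hci : c⁻¹ ≠ ∞ := ENNReal.inv_ne_top.2 hc0
  set M : ℝ≥0∞ := max L (C₁ + c⁻¹) + 1 with hM
  have hMt : M ≠ ∞ := by simp [hM, hLt, hC₁t, hc0]
  have hM0 : M ≠ 0 := by simp [hM]
  refine ⟨M.toNNReal, ENNReal.toNNReal_pos hM0 hMt, fun σ _ hσ => ⟨?_, ?_⟩⟩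
  · rintro ⟨ha, hb, hloc⟩
    obtain ⟨u, hu, huL⟩ := hL σ hσ
    refine ⟨u, hu, ⟨hu.measurable.aemeasurable, fun K hK =>
      WolffEq.lintegral_rpow_lt_top_of_le_tailPotential hp hq hqp ha hb hloc hLt huL hK⟩,
      fun x => ?_⟩
    rw [ENNReal.coe_toNNReal hMt]
    constructor
    · rw [← ENNReal.div_eq_inv_mul]
      refine ENNReal.div_le_of_le_mul' ?_
      calc _ ≤ C₁ * u x + c⁻¹ * u x := by
            refine add_le_add (hC₁ σ u hu.isSupersolution x) ?_
            exact WolffEq.le_inv_mul_of_mul_le hc0 hct (hc σ u hu.isSupersolution x)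
        _ = (C₁ + c⁻¹) * u x := by ring
        _ ≤ M * u x := by
            gcongr
            exact (le_max_right _ _).trans le_self_add
    · refine (huL x).trans (mul_le_mul' ?_ le_rfl)
      exact (le_max_left _ _).trans le_self_add
  · rintro ⟨u, hu, hloc⟩
    obtain ⟨v, hv, huv⟩ := hu.exists_isSolution hp hq
    exact hv.conditions hp hq hqp hσ (hloc.congr_ae huv)
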